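/- **Setting.** Let $f:\mathbb R^n\to\mathbb R$, $h=(h_1,\dots,h_m):\mathbb R^n\to\mathbb R^m$, $g=(g_1,\dots,g_l):\mathbb R^n\to\mathbb R^l$ and $X=\{x\in\mathbb R^n: g(x)\le 0\}$, with Euclidean norms throughout. Assume that $X$ is compact; each $g_j$ is convex and differentiable with $L_{g_j}$-Lipschitz gradient on $\mathbb R^n$; $f$ is differentiable at the points of $X$ and $\nabla f$ is $L_f$-Lipschitz on $X$; each $h_i$ is convex on $\mathbb R^n$, differentiable at the points of $X$, and $\nabla h_i$ is $L_{h_i}$-Lipschitz on $X$. Put $\nabla_f=\max_{x\in X}\|\nabla f(x)\|$, $D_X=\max_{u,v\in X}\|u-v\|$, $L_h=(\sum_i L_{h_i}^2)^{1/2}$, $L_g=(\sum_j L_{g_j}^2)^{1/2}$. Let $J(x)$ be the $(m+l)\times n$ matrix with rows $\nabla h_1(x),\dots,\nabla h_m(x),\nabla g_1(x),\dots,\nabla g_l(x)$, and let $J_S(x)$ be its submatrix with rows in $S\subseteq[m+l]$. For $r\in\mathbb R^m$ let $A_r[x]\subseteq[m+l]$ be the set of indices of the constraints with $h_i(x)=r_i$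 or $g_j(x)=0$, and write $A[x]=A_0[x]$. Let $X^*$ be the set of stationary points, i.e. of all $x\in X$ with $h(x)\le 0$ for which some $y\in\mathbb R^m_+$ satisfies $0\in\nabla f(x)+\sum_i y_i\nabla h_i(x)+N_X(x)$ and $\langle y,h(x)\rangle=0$. Let $\sigma_{X^*}\in[0,\infty]$ be the infimum, over $x\in X^*$ and $S\subseteq A[x]$, of $\sigma_{\min}(J_S(x)^\top)=\min_{\|v\|=1}\|J_S(x)^\top v\|$ (which is $\infty$ for $S=\emptyset$). Assume that * there are $\hat x\in X$ and $\Delta_0>0$ with $h_i(\hat x)\le-\Delta_0$ for all $i$; * $\sigma_{X^*}>0$. Fix any real $\sigma$ with $0<\sigma\le\sigma_{X^*}$ (in particular $\sigma=\sigma_{X^*}$ if this is finite). Let $p>L_f$, $\mu_K=p-L_f$, $B>(4\nabla_f D_X+2pD_X^2)/\Delta_0$, $Y=[0,B]^m$, $K(x,z;y)=f(x)+\langle y,h(x)\rangle+\frac p2\|x-z\|^2$ and $\Lambda=(2\nabla_f+2pD_X)/\sigma$. Define $$x(y,z)=\operatorname*{argmin}_{x\in X}K(x,z;y),\qquad x(z)=\operatorname*{argmin}_{x\in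 X}\max_{y\in Y}K(x,z;y),$$ $$x^*(r,z)=\operatorname*{argmin}_{x\in X}\Big(f(x)+\max_{y\in Y}\langle y,h(x)-r\rangle+\tfrac p2\|x-z\|^2\Big),$$ and, for $\delta>0$, $\Omega_\delta=\{(r,z):\max\{\|x(z)-z\|,\|r\|\}\le\delta\}$. A set $\mathcal B\subseteq[m+l]$ is a *basic set* of $(r,z)\in\Omega_\delta$ if, with $x=x^*(r,z)$, the matrix $J_{\mathcal B}(x)$ has full row rank and there are $y\in\mathbb R^m_+$, $\mu\in\mathbb R^l_+$ with $$\nabla f(x)+\sum_i y_i\nabla h_i(x)+\sum_j\mu_j\nabla g_j(x)+p(x-z)=0,$$ such that $h_i(x)=r_i$ and $g_j(x)=0$ for the indices in $\mathcal B$, $y_i=0$ and $\mu_j=0$ for the indices outside $\mathcal B$, and $\max\{\|y\|,\|\mu\|\}\le\Lambda$. Call $\hat\delta\in(0,\Delta_0/4]$ a *regularity radius* if $\sigma_{\min}(J_S(x^*(r,z))^\top)\ge\sigma/2$ for all $(r,z)\in\Omega_{\hat\delta}$ with $z\in X$ and all $S\subseteq A_r[x^*(r,z)]$. **Proposition.**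 A regularity radius exists. Moreover, let $\hat\delta$ be any regularity radius, $\Omega=\Omega_{\hat\delta}$, $\alpha>0$, $z\in X$, $y\in Y$, and put $$y_+(z)=\Pi_Y\big(y+\alpha h(x(y,z))\big),\qquad \tilde r=\frac{y_+(z)}{\alpha}+h(x(y_+(z),z))-\frac y\alpha-h(x(y,z)).$$ If $(\tilde r,z)\in\Omega$, then $x^*(\tilde r,z)=x(y_+(z),z)$, and there are an integer $K$ and numbers $0=\theta^0<\theta^1<\dots<\theta^K=1$ such that, for every $k\in\{0,\dots,K-1\}$, the points $(\theta^k\tilde r,z)$ and $(\theta^{k+1}\tilde r,z)$ lie in $\Omega$ and have a common basic set. Moreover, $$\|x^*(\tilde r,z)-x^*(0,z)\|\le\frac{2\big(L_f+p+\Lambda\sqrt{L_h^2+L_g^2}\big)}{\mu_K\,\sigma}\,\|\tilde r\|.$$ -/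

import Mathlib

open scoped NNReal ENNReal

noncomputable section

/-- `ℝ^k` with the Euclidean norm. -/
abbrev Euc (k : ℕ) : Type := EuclideanSpace ℝ (Fin k)

/-- A minimizer of `F` over the set `S` (an arbitrary vector if there is none). -/
def argminOn {k : ℕ} (F : Euc k → ℝ) (S : Set (Euc k)) : Euc k :=
  Classical.epsilon fun x => x ∈ S ∧ IsMinOn F S x

/-- The Euclidean projection of `w` onto `S`. -/
def projOn {k : ℕ} (S : Set (Euc k)) (w : Euc k) : Euc k :=
  argminOn (fun y => ‖y - w‖) S

/-- The normal cone of the convex set `S` at `x`. -/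
def normalConeAt {k : ℕ} (S : Set (Euc k)) (x : Euc k) : Set (Euc k) :=
  {v | ∀ u ∈ S, inner ℝ v (u - x) ≤ 0}

/-- The box `[0, B]^m`. -/
def dualBox (m : ℕ) (B : ℝ) : Set (Euc m) :=
  {y | ∀ i, 0 ≤ y i ∧ y i ≤ B}

/-- The root of the sum of the squares of the Lipschitz constants `L i`. -/
def rootSumSq {k : ℕ} (L : Fin k → ℝ≥0) : ℝ :=
  Real.sqrt (∑ i, (L i : ℝ) ^ 2)

/-- The data of the program `min f(x)` subject to `h(x) ≤ 0` and `x ∈ X = {g ≤ 0}` in `ℝ^n`, with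
`m` constraint functions `h i` and `l` constraint functions `g j`. -/
structure NLP (n m l : ℕ) where
  f : Euc n → ℝ
  h : Fin m → Euc n → ℝ
  g : Fin l → Euc n → ℝ

namespace NLP

variable {n m l : ℕ} (P : NLP n m l)

/-- `X = {x : g(x) ≤ 0}`. -/
def X : Set (Euc n) := {x | ∀ j, P.g j x ≤ 0}

/-- The vector `h(x) ∈ ℝ^m`. -/
def hVec (x : Euc n) : Euc m := WithLp.toLp 2 fun i => P.h i x

/-- The row of the Jacobian `J(x)` of all constraints with the given index; the index set `[m + l]`
is written as `Fin m ⊕ Fin l`. -/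
def jacRow (x : Euc n) : Fin m ⊕ Fin l → Euc n
  | Sum.inl i => gradient (P.h i) x
  | Sum.inr j => gradient (P.g j) x

/-- `∇_f = max_{x ∈ X} ‖∇f(x)‖`. -/
def gradBound : ℝ := sSup ((fun x => ‖gradient P.f x‖) '' P.X)

/-- `D_X = max_{u, v ∈ X} ‖u - v‖`. -/
def diamX : ℝ := Metric.diam P.X

/-- The set `X*` of stationary points of the program. -/
def stationarySet : Set (Euc n) :=
  {x | x ∈ P.X ∧ ∃ y : Euc m, (∀ i, 0 ≤ y i) ∧
    -(gradient P.f x + ∑ i, y i • gradient (P.h i) x) ∈ normalConeAt P.X x ∧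
    (∀ i, P.h i x ≤ 0) ∧ inner ℝ y (P.hVec x) = 0}

/-- The active set at `x` of the constraints `h ≤ r`, `g ≤ 0`. -/
def activeSet (r : Euc m) (x : Euc n) : Set (Fin m ⊕ Fin l) :=
  {k | Sum.elim (fun i => P.h i x = r i) (fun j => P.g j x = 0) k}

/-- The smallest singular value of `J_S(x)ᵀ`, that is, the minimum of `‖J_S(x)ᵀ v‖` over the unit
vectors `v` indexed by `S`; it is `∞` if `S` is empty. -/
def sigmaMin (S : Finset (Fin m ⊕ Fin l)) (x : Euc n) : ℝ≥0∞ :=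
  ⨅ (v : EuclideanSpace ℝ S) (_ : ‖v‖ = 1), ENNReal.ofReal ‖∑ i : S, v i • P.jacRow x i‖

/-- The constant `σ_{X*}`: the infimum of the smallest singular values of `J_S(x)ᵀ` over the
stationary points `x` and the sets `S` of constraints active at `x`. -/
def sigmaStar : ℝ≥0∞ :=
  ⨅ (x : Euc n) (_ : x ∈ P.stationarySet) (S : Finset (Fin m ⊕ Fin l))
    (_ : (S : Set (Fin m ⊕ Fin l)) ⊆ P.activeSet 0 x), P.sigmaMin S x

/-- The proximal Lagrangian `K(x, z; y)`. -/
def proxLag (p : ℝ) (x z : Euc n) (y : Euc m) : ℝ :=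
  P.f x + inner ℝ y (P.hVec x) + p / 2 * ‖x - z‖ ^ 2

/-- `x(y, z) = argmin_{x ∈ X} K(x, z; y)`. -/
def xDual (p : ℝ) (y : Euc m) (z : Euc n) : Euc n :=
  argminOn (fun x => P.proxLag p x z y) P.X

/-- `x*(r, z) = argmin_{x ∈ X} f(x) + max_{y ∈ Y} ⟨y, h(x) - r⟩ + (p/2) ‖x - z‖²`, where
`Y = [0, B]^m`. -/
def xPert (p B : ℝ) (r : Euc m) (z : Euc n) : Euc n :=
  argminOn (fun x => P.f x + sSup ((fun y => inner ℝ y (P.hVec x - r)) '' dualBox m B)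
    + p / 2 * ‖x - z‖ ^ 2) P.X

/-- `x(z) = argmin_{x ∈ X} max_{y ∈ Y} K(x, z; y)`. -/
def xProx (p B : ℝ) (z : Euc n) : Euc n :=
  argminOn (fun x => sSup ((fun y => P.proxLag p x z y) '' dualBox m B)) P.X

/-- `y_+(z) = Π_Y(y + α h(x(y, z)))`. -/
def yPlus (p B α : ℝ) (y : Euc m) (z : Euc n) : Euc m :=
  projOn (dualBox m B) (y + α • P.hVec (P.xDual p y z))

/-- `r̃ = y_+(z)/α + h(x(y_+(z), z)) - y/α - h(x(y, z))`. -/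
def rTilde (p B α : ℝ) (y : Euc m) (z : Euc n) : Euc m :=
  α⁻¹ • P.yPlus p B α y z + P.hVec (P.xDual p (P.yPlus p B α y z) z)
    - α⁻¹ • y - P.hVec (P.xDual p y z)

/-- The neighbourhood `Ω` of radius `δ`. -/
def Omega (p B δ : ℝ) : Set (Euc m × Euc n) :=
  {q | max ‖P.xProx p B q.2 - q.2‖ ‖q.1‖ ≤ δ}

/-- `δ` is a radius such that, for all `(r, z) ∈ Ω` with `z ∈ X`, every set `S` of constraints
active at `x*(r, z)` in the problem with constraints `h ≤ r`, `g ≤ 0` has a Jacobian `J_S` whose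
smallest singular value is at least `σ / 2`. -/
def IsRegularityRadius (p B Δ₀ σ δ : ℝ) : Prop :=
  0 < δ ∧ δ ≤ Δ₀ / 4 ∧
    ∀ (r : Euc m) (z : Euc n), z ∈ P.X → (r, z) ∈ P.Omega p B δ →
      ∀ S : Finset (Fin m ⊕ Fin l),
        (S : Set (Fin m ⊕ Fin l)) ⊆ P.activeSet r (P.xPert p B r z) →
          ENNReal.ofReal (σ / 2) ≤ P.sigmaMin S (P.xPert p B r z)

/-- `Λ = (2 ∇_f + 2 p D_X) / σ`. -/
def multBound (p σ : ℝ) : ℝ := (2 * P.gradBound + 2 * p * P.diamX) / σ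

/-- `S` is a basic set of `(r, z)`, with multipliers bounded by `Λ`. -/
def IsBasicSet (p B Λ : ℝ) (S : Finset (Fin m ⊕ Fin l)) (r : Euc m) (z : Euc n) : Prop :=
  LinearIndependent ℝ (fun i : S => P.jacRow (P.xPert p B r z) i) ∧
  ∃ (y : Euc m) (μ : Euc l), (∀ i, 0 ≤ y i) ∧ (∀ j, 0 ≤ μ j) ∧
    gradient P.f (P.xPert p B r z)
      + (∑ i, y i • gradient (P.h i) (P.xPert p B r z)
        + ∑ j, μ j • gradient (P.g j) (P.xPert p B r z))
      + p • (P.xPert p B r z - z) = 0 ∧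
    (∀ i, Sum.inl i ∈ S → P.h i (P.xPert p B r z) = r i) ∧
    (∀ j, Sum.inr j ∈ S → P.g j (P.xPert p B r z) = 0) ∧
    (∀ i, Sum.inl i ∉ S → y i = 0) ∧
    (∀ j, Sum.inr j ∉ S → μ j = 0) ∧
    max ‖y‖ ‖μ‖ ≤ Λ

/-- `(r, z)` and `(r', z)` are points of `Ω` that share a basic set. -/
def ShareBasicSet (p B Λ δ : ℝ) (r r' : Euc m) (z : Euc n) : Prop :=
  (r, z) ∈ P.Omega p B δ ∧ (r', z) ∈ P.Omega p B δ ∧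
    ∃ S : Finset (Fin m ⊕ Fin l), P.IsBasicSet p B Λ S r z ∧ P.IsBasicSet p B Λ S r' z

end NLP

end

/-! ### Limits in a parameter and Farkas' lemma for independent vectors. -/

noncomputable section

open Filter Topology

/-! Maximizing over the box turns `xPert` into the minimizer over `X` of `f` plus the proximal term
plus `B` times the total violation of `h ≤ r`. Since `p > Lf`, this minimizer is unique, hence
continuous in `(r, z)` by compactness. Since `B` is large and Slater's condition has slack, the
penalty is exact for `‖r‖ ≤ Δ₀ / 4` (`h_xPert_le`).

A regularity radius exists by compactness. Where regularity fails, `max ‖x(z) - z‖ ‖r‖` is positive,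
because its vanishing means `r = 0` and `x(z) = z`, which makes `z` stationary (`mem_stationarySet`)
and contradicts `σ ≤ σ_{X*}`. The identity for `r̃` is a saddle-point argument (`xPert_rTilde`).

Inside `Ω`, regularity yields multipliers bounded by `Λ`. For a fixed index set `S`, the `t ∈ [0,
1]` at which `(t r̃, z)` has multipliers supported on active constraints in `S` form a closed set.
The finitely many such sets cover `[0, 1]`, and `exists_partition_of_finite_closed_cover` extracts
the chain.

Two perturbations sharing `S` satisfy `μ_K ‖Δx‖² ≤ ‖Δc‖ ‖Δr‖` by monotonicity and `(σ/2) ‖Δc‖ ≤ (L_f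
+ p + Λ √(L_h² + L_g²)) ‖Δx‖` by regularity. Combining them bounds `‖Δx‖` by a multiple of `‖Δr‖`
(`norm_xPert_sub_le`), and these bounds add up along the segment without loss. -/

theorem nonneg_of_forall_pos_add_mul_nonneg {N T : ℝ} (h : ∀ ε > 0, 0 ≤ N + ε * T) : 0 ≤ N := by
  have hlim : Tendsto (fun ε : ℝ => N + ε * T) (𝓝[>] 0) (𝓝 (N + 0 * T)) :=
    ((continuous_const.add (continuous_id.mul continuous_const)).tendsto 0).mono_left
      nhdsWithin_le_nhds
  rw [zero_mul, add_zero] at hlim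
  exact ge_of_tendsto hlim (by filter_upwards [self_mem_nhdsWithin] with ε hε using h ε hε)

theorem nonneg_of_forall_pos_add_mul {N T : ℝ} (h : ∀ ε > 0, 0 < N + ε * T) : 0 ≤ N :=
  nonneg_of_forall_pos_add_mul_nonneg fun ε hε => (h ε hε).le

/-- Prescribed inner products with linearly independent vectors. -/
theorem LinearIndependent.exists_inner_eq {E ι : Type*} [NormedAddCommGroup E]
    [InnerProductSpace ℝ E] [Finite ι] {a : ι → E}
    (ha : LinearIndependent ℝ a) (w : ι → ℝ) : ∃ d, ∀ i, inner ℝ (a i) d = w i := by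
  classical
  have : FiniteDimensional ℝ (Submodule.span ℝ (Set.range a)) :=
    FiniteDimensional.span_of_finite ℝ (Set.finite_range a)
  let b := Module.Basis.span ha
  let F : Submodule.span ℝ (Set.range a) →ₗ[ℝ] ℝ := b.constr ℝ w
  let F' : Submodule.span ℝ (Set.range a) →L[ℝ] ℝ := LinearMap.toContinuousLinearMap F
  have : CompleteSpace (Submodule.span ℝ (Set.range a)) := FiniteDimensional.complete ℝ _
  refine ⟨((InnerProductSpace.toDual ℝ (Submodule.span ℝ (Set.range a))).symm F' : E),
    fun i => ?_⟩
  have h1 : inner ℝ ((InnerProductSpace.toDual ℝ (Submodule.span ℝ (Set.range a))).symm F') (b i)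
      = F' (b i) := InnerProductSpace.toDual_symm_apply
  have h2 : F' (b i) = w i := by simp [F', F]
  rw [h2, Submodule.coe_inner] at h1
  rw [real_inner_comm, ← h1]
  congr 1
  simp [b, Module.Basis.span_apply]

/-- Farkas' lemma with strict inequalities for linearly independent vectors. -/
theorem LinearIndependent.exists_nonneg_combination {E ι : Type*}
    [NormedAddCommGroup E] [InnerProductSpace ℝ E] [Fintype ι] {a : ι → E}
    (ha : LinearIndependent ℝ a) {v : E}
    (hv : ∀ d, (∀ i, inner ℝ (a i) d < 0) → 0 ≤ inner ℝ v d) :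
    ∃ c : ι → ℝ, (∀ i, 0 ≤ c i) ∧ v + ∑ i, c i • a i = 0 := by
  classical
  have hv' : ∀ d, (∀ i, inner ℝ (a i) d ≤ 0) → 0 ≤ inner ℝ v d := by
    intro d hd
    -- Independence supplies a direction strictly inside the cone; adding a small multiple of it
    -- makes weak inequalities strict.
    obtain ⟨d₀, hd₀⟩ := ha.exists_inner_eq fun _ => (-1 : ℝ)
    refine nonneg_of_forall_pos_add_mul_nonneg (T := inner ℝ v d₀) fun ε hε => ?_
    have := hv (d + ε • d₀) fun i => by
      rw [inner_add_right, inner_smul_right, hd₀]; linarith [hd i]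
    rwa [inner_add_right, inner_smul_right] at this
  have : FiniteDimensional ℝ (Submodule.span ℝ (Set.range a)) :=
    FiniteDimensional.span_of_finite ℝ (Set.finite_range a)
  have : CompleteSpace (Submodule.span ℝ (Set.range a)) := FiniteDimensional.complete ℝ _
  -- If `d` is orthogonal to every `a i`, both `d` and `-d` are admissible, so `v` is orthogonal to
  -- `d`.
  have hspan : v ∈ Submodule.span ℝ (Set.range a) := by
    rw [← Submodule.orthogonal_orthogonal (Submodule.span ℝ (Set.range a)),
      Submodule.mem_orthogonal']
    intro d hd
    have h0 : ∀ i, inner ℝ (a i) d = 0 := fun i =>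
      (Submodule.mem_orthogonal _ _).1 hd _ (Submodule.subset_span ⟨i, rfl⟩)
    have h1 := hv' d fun i => (h0 i).le
    have h2 := hv' (-d) fun i => by rw [inner_neg_right, h0, neg_zero]
    rw [inner_neg_right] at h2
    linarith
  obtain ⟨c, hc⟩ := (Submodule.mem_span_range_iff_exists_fun ℝ).1 hspan
  refine ⟨fun i => -c i, fun i => ?_, by rw [← hc]; simp⟩
  obtain ⟨d, hd⟩ := ha.exists_inner_eq fun j => if j = i then (-1 : ℝ) else 0
  have h := hv' d fun j => by rw [hd]; split_ifs <;> norm_num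
  rw [← hc, sum_inner] at h
  simpa [inner_smul_left, hd] using h

/-! ### First-order conditions and continuity of minimizers. -/

section Generic

variable {E : Type*} [NormedAddCommGroup E] [InnerProductSpace ℝ E] [CompleteSpace E]

/-- The one-sided difference quotients converge to the directional derivative. -/
theorem HasGradientAt.tendsto_slope {G : E → ℝ} {a x : E} (hG : HasGradientAt G a x) (d : E) :
    Tendsto (fun t : ℝ => t⁻¹ * (G (x + t • d) - G x)) (𝓝[>] 0) (𝓝 (inner ℝ a d)) := by
  have h1 : HasLineDerivAt ℝ G (InnerProductSpace.toDual ℝ E a d) x d :=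
    hG.hasFDerivAt.hasLineDerivAt d
  have h2 : HasDerivAt (fun t : ℝ => G (x + t • d)) (inner ℝ a d) 0 := by
    simpa [HasLineDerivAt] using h1
  simpa using h2.tendsto_slope_zero_right

theorem HasGradientAt.eventually_lt_of_inner_neg {c : E → ℝ} {a x d : E}
    (hc : HasGradientAt c a x) (hd : inner ℝ a d < 0) :
    ∀ᶠ t : ℝ in 𝓝[>] 0, c (x + t • d) < c x := by
  filter_upwards [(hc.tendsto_slope d).eventually_lt_const hd, self_mem_nhdsWithin] with t ht ht0
  have : (0 : ℝ) < t⁻¹ := inv_pos.2 ht0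
  nlinarith

/-- The variational inequality at a minimizer of the sum of a differentiable and a convex
function. -/
theorem IsMinOn.variational_inequality {S : Set E} {G V : E → ℝ} {a x u : E}
    (hV : ConvexOn ℝ S V) (hG : HasGradientAt G a x) (hx : x ∈ S) (hu : u ∈ S)
    (hmin : IsMinOn (fun w => G w + V w) S x) :
    0 ≤ inner ℝ a (u - x) + (V u - V x) := by
  have hlim := (hG.tendsto_slope (u - x)).add_const (V u - V x)
  refine ge_of_tendsto hlim ?_
  have h1 : ∀ᶠ t : ℝ in 𝓝[>] 0, t < 1 :=
    mem_nhdsWithin_of_mem_nhds (Iio_mem_nhds one_pos)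
  filter_upwards [h1, self_mem_nhdsWithin] with t ht1 ht0
  have ht0 : 0 < t := ht0
  have e : x + t • (u - x) = (1 - t) • x + t • u := by module
  have hm : x + t • (u - x) ∈ S := by
    rw [e]; exact hV.1 hx hu (by linarith) ht0.le (by ring)
  have hv := hV.2 hx hu (by linarith : 0 ≤ 1 - t) ht0.le (by ring)
  rw [← e] at hv
  simp only [smul_eq_mul] at hv
  have hφ := isMinOn_iff.1 hmin _ hm
  have : 0 ≤ t⁻¹ * (G (x + t • (u - x)) - G x + t * (V u - V x)) :=
    mul_nonneg (inv_pos.2 ht0).le (by linarith)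
  rwa [mul_add, inv_mul_cancel_left₀ ht0.ne'] at this

/-- A convex function lies above its tangent planes. -/
theorem ConvexOn.inner_gradient_le {c : E → ℝ} (hc : ConvexOn ℝ Set.univ c) {x : E}
    (hx : DifferentiableAt ℝ c x) (u : E) : inner ℝ (gradient c x) (u - x) ≤ c u - c x := by
  -- The sum of `-c` (differentiable part) and `c` (convex part) is zero, so every point is a
  -- minimizer and the variational inequality applies.
  have hG : HasGradientAt (fun w => -c w) (-gradient c x) x := by
    have := hx.hasGradientAt.hasFDerivAt.neg
    rw [hasGradientAt_iff_hasFDerivAt, map_neg]; exact this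
  have := IsMinOn.variational_inequality hc hG (Set.mem_univ x) (Set.mem_univ u)
    (isMinOn_iff.2 fun w _ => by simp)
  rw [inner_neg_left] at this
  linarith

/-- The unique minimizer over a compact set depends continuously on the parameter. -/
theorem continuous_of_unique_isMinOn {Q X : Type*} [TopologicalSpace Q] [TopologicalSpace X]
    {K : Set X} (hK : IsCompact K) {φ : Q → X → ℝ}
    (hφ : ContinuousOn (fun q : Q × X => φ q.1 q.2) (Set.univ ×ˢ K)) {ξ : Q → X}
    (hξ : ∀ q, ξ q ∈ K) (hmin : ∀ q, IsMinOn (φ q) K (ξ q))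
    (huniq : ∀ q, ∀ x ∈ K, IsMinOn (φ q) K x → x = ξ q) : Continuous ξ := by
  -- By compactness it suffices that each cluster point of `ξ` at `q` minimizes `φ q`; uniqueness
  -- then identifies it with `ξ q`.
  refine continuous_iff_continuousAt.2 fun q =>
    hK.tendsto_nhds_of_unique_mapClusterPt (Eventually.of_forall hξ) fun x hx hcl =>
      huniq q x hx (isMinOn_iff.2 fun u hu => ?_)
  obtain ⟨U, hU, hUx⟩ := mapClusterPt_iff_ultrafilter.1 hcl
  have h1 : Tendsto (fun q' => φ q' (ξ q')) U (𝓝 (φ q x)) :=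
    (hφ (q, x) ⟨trivial, hx⟩).tendsto.comp
      (tendsto_nhdsWithin_iff.2 ⟨Tendsto.prodMk_nhds hU hUx,
        Eventually.of_forall fun q' => ⟨trivial, hξ q'⟩⟩)
  have h2 : Tendsto (fun q' => φ q' u) U (𝓝 (φ q u)) :=
    (hφ (q, u) ⟨trivial, hu⟩).tendsto.comp
      (tendsto_nhdsWithin_iff.2 ⟨Tendsto.prodMk_nhds hU tendsto_const_nhds,
        Eventually.of_forall fun q' => ⟨trivial, hu⟩⟩)
  exact le_of_tendsto_of_tendsto' h1 h2 fun q' => isMinOn_iff.1 (hmin q') u hu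

end Generic

/-! ### Partitions of an interval subordinate to a finite closed cover. -/

/-- A finite closed cover of `[t, 1]` admits a partition of `[t, 1]` whose consecutive points lie
in common sets of the cover. -/
theorem exists_partition_of_finite_closed_cover {ι : Type*} [Finite ι] {Θ : ι → Set ℝ}
    (hΘ : ∀ i, IsClosed (Θ i)) {t : ℝ} (ht : t ≤ 1) (hcov : ∀ s ∈ Set.Icc t 1, ∃ i, s ∈ Θ i) :
    ∃ (K : ℕ) (θ : Fin (K + 1) → ℝ), θ 0 = t ∧ θ (Fin.last K) = 1 ∧ StrictMono θ ∧
      ∀ k : Fin K, ∃ i, θ k.castSucc ∈ Θ i ∧ θ k.succ ∈ Θ i := by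
  classical
  have := Fintype.ofFinite ι
  -- The induction counts the sets meeting `(t, 1]`. Jumping from `t` to the last point of a set
  -- accumulating at `t` removes that set from the count.
  induction hn : (Finset.univ.filter fun i => ∃ s ∈ Θ i, t < s ∧ s ≤ 1).card
    using Nat.strong_induction_on generalizing t with
  | _ N ih =>
  rcases ht.eq_or_lt with rfl | ht1
  · exact ⟨0, fun _ => 1, rfl, rfl, Fin.strictMono_iff_lt_succ.2 fun k => k.elim0, fun k => k.elim0⟩
  have hev : ∀ᶠ s in 𝓝[>] t, ∃ i, s ∈ Θ i := by
    filter_upwards [Ioc_mem_nhdsGT ht1] with s hs using hcov s ⟨hs.1.le, hs.2⟩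
  -- One of finitely many sets must recur arbitrarily close to `t` from the right. Closedness puts
  -- `t` in it too, and it also contains a point beyond `t`.
  obtain ⟨i, hi⟩ : ∃ i, ∃ᶠ s in 𝓝[>] t, s ∈ Θ i := by
    by_contra! h
    have h2 : ∀ᶠ s in 𝓝[>] t, ∀ i, s ∉ Θ i :=
      eventually_all.2 h
    obtain ⟨s, ⟨j, hj⟩, hs⟩ := (hev.and h2).exists
    exact hs j hj
  have hti : t ∈ Θ i := (hΘ i).mem_of_frequently_of_tendsto hi
    (tendsto_id.mono_right nhdsWithin_le_nhds)
  obtain ⟨s, hsi, hs⟩ := (hi.and_eventually (Ioc_mem_nhdsGT ht1)).exists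
  have hcomp : IsCompact (Θ i ∩ Set.Icc t 1) := isCompact_Icc.inter_left (hΘ i)
  obtain ⟨s', ⟨hs'i, hs'⟩, hmax⟩ := hcomp.exists_isMaxOn ⟨s, hsi, hs.1.le, hs.2⟩
    continuousOn_id
  have hts' : t < s' := hs.1.trans_le (isMaxOn_iff.1 hmax s ⟨hsi, hs.1.le, hs.2⟩)
  obtain ⟨K, θ, h0, h1, hmono, hsh⟩ := ih _ (by
    rw [← hn]
    refine Finset.card_lt_card (Finset.ssubset_iff_of_subset ?_ |>.2 ⟨i, ?_, ?_⟩)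
    · intro j
      simp only [Finset.mem_filter, Finset.mem_univ, true_and]
      rintro ⟨w, hw, h1, h2⟩
      exact ⟨w, hw, hts'.trans h1, h2⟩
    · simpa using ⟨s, hsi, hs⟩
    · simp only [Finset.mem_filter, Finset.mem_univ, true_and]
      rintro ⟨w, hw, h1, h2⟩
      exact absurd (isMaxOn_iff.1 hmax w ⟨hw, (hts'.trans h1).le, h2⟩) (not_le.2 h1))
    hs'.2 (fun w hw => hcov w ⟨hts'.le.trans hw.1, hw.2⟩) rfl
  refine ⟨K + 1, Fin.cons t θ, rfl, by rw [← Fin.succ_last, Fin.cons_succ, h1], ?_, ?_⟩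
  · refine Fin.strictMono_iff_lt_succ.2 fun k => ?_
    refine Fin.cases ?_ (fun k => ?_) k
    · simpa [h0] using hts'
    · rw [← Fin.succ_castSucc, Fin.cons_succ, Fin.cons_succ]
      exact hmono (Fin.castSucc_lt_succ)
  · intro k
    refine Fin.cases ?_ (fun k => ?_) k
    · exact ⟨i, by simpa using hti, by simpa [h0] using hs'i⟩
    · rw [← Fin.succ_castSucc, Fin.cons_succ, Fin.cons_succ]
      exact hsh k

/-- Bounds on the increments along a partition add up. -/
theorem dist_le_of_forall_dist_succ_le {F : Type*} [PseudoMetricSpace F] {K : ℕ}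
    {x : Fin (K + 1) → F} {θ : Fin (K + 1) → ℝ} {C : ℝ}
    (h : ∀ k : Fin K, dist (x k.succ) (x k.castSucc) ≤ C * (θ k.succ - θ k.castSucc))
    (k : Fin (K + 1)) : dist (x k) (x 0) ≤ C * (θ k - θ 0) := by
  induction k using Fin.induction with
  | zero => simp
  | succ k ih => linarith [dist_triangle (x k.succ) (x k.castSucc) (x 0), h k]

/-! ### Minimizers on compact sets and the dual box. -/

theorem argminOn_spec {k : ℕ} {F : Euc k → ℝ} {S : Set (Euc k)} (hS : IsCompact S)
    (hne : S.Nonempty) (hF : ContinuousOn F S) :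
    argminOn F S ∈ S ∧ IsMinOn F S (argminOn F S) :=
  Classical.epsilon_spec (hS.exists_isMinOn hne hF)

/-- The maximum of `⟨y, w⟩` over the box `[0, B]^m`. -/
theorem isGreatest_inner_dualBox {m : ℕ} {B : ℝ} (hB : 0 ≤ B) (w : Euc m) :
    IsGreatest ((fun y => inner ℝ y w) '' dualBox m B) (B * ∑ i, max (w i) 0) := by
  constructor
  · refine ⟨WithLp.toLp 2 fun i => if 0 ≤ w i then B else 0, fun i => ?_, ?_⟩
    · dsimp only; split_ifs <;> simp [hB]
    · simp only [PiLp.inner_apply, RCLike.inner_apply, conj_trivial, Finset.mul_sum]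
      refine Finset.sum_congr rfl fun i _ => ?_
      split_ifs with h
      · rw [max_eq_left h]; ring
      · rw [max_eq_right (not_le.1 h).le]; ring
  · rintro _ ⟨y, hy, rfl⟩
    simp only [PiLp.inner_apply, RCLike.inner_apply, conj_trivial, Finset.mul_sum]
    refine Finset.sum_le_sum fun i _ => ?_
    rcases le_total 0 (w i) with h | h
    · rw [max_eq_left h, mul_comm]; exact mul_le_mul_of_nonneg_right (hy i).2 h
    · rw [max_eq_right h, mul_zero]; exact mul_nonpos_of_nonpos_of_nonneg h (hy i).1

theorem isCompact_dualBox (m : ℕ) (B : ℝ) : IsCompact (dualBox m B) := by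
  have h : dualBox m B = (EuclideanSpace.equiv (Fin m) ℝ).symm ''
      Set.pi Set.univ fun _ => Set.Icc 0 B := by
    ext y
    constructor
    · exact fun hy => ⟨fun i => y i, fun i _ => hy i, rfl⟩
    · rintro ⟨w, hw, rfl⟩ i
      exact hw i trivial
  rw [h]
  exact (isCompact_univ_pi fun _ => isCompact_Icc).image (ContinuousLinearEquiv.continuous _)

theorem convex_dualBox (m : ℕ) (B : ℝ) : Convex ℝ (dualBox m B) := by
  intro y hy y' hy' a b ha hb hab i
  exact convex_Icc 0 B (hy i) (hy' i) ha hb hab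

theorem zero_mem_dualBox {m : ℕ} {B : ℝ} (hB : 0 ≤ B) : (0 : Euc m) ∈ dualBox m B :=
  fun _ => ⟨le_rfl, hB⟩

theorem projOn_dualBox_mem {m : ℕ} {B : ℝ} (hB : 0 ≤ B) (w : Euc m) :
    projOn (dualBox m B) w ∈ dualBox m B :=
  (argminOn_spec (isCompact_dualBox m B) ⟨0, zero_mem_dualBox hB⟩ (by fun_prop)).1

/-- The variational inequality for the projection onto the box. -/
theorem inner_sub_projOn_dualBox_le {m : ℕ} {B : ℝ} (hB : 0 ≤ B) (w : Euc m) {u : Euc m}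
    (hu : u ∈ dualBox m B) :
    inner ℝ (w - projOn (dualBox m B) w) (u - projOn (dualBox m B) w) ≤ 0 := by
  have hmin := (argminOn_spec (isCompact_dualBox m B) ⟨0, zero_mem_dualBox hB⟩
    (by fun_prop : ContinuousOn (fun y : Euc m => ‖y - w‖) _)).2
  have hmem := projOn_dualBox_mem hB w
  refine (norm_eq_iInf_iff_real_inner_le_zero (convex_dualBox m B) hmem).1 ?_ u hu
  have : Nonempty (dualBox m B) := ⟨⟨0, zero_mem_dualBox hB⟩⟩
  refine le_antisymm (le_ciInf fun v => ?_)
    (ciInf_le ⟨0, by rintro _ ⟨v, rfl⟩; exact norm_nonneg _⟩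
      (⟨_, hmem⟩ : dualBox m B))
  rw [norm_sub_rev, norm_sub_rev w]
  exact isMinOn_iff.1 hmin v v.2

/-! ### The perturbed problem as a penalized problem. -/

namespace NLP

variable {n m l : ℕ} (P : NLP n m l)

/-- Smoothness and convexity of the data on the compact set `X`. -/
structure IsSmoothConvex (Lf : ℝ≥0) (Lh : Fin m → ℝ≥0) (Lg : Fin l → ℝ≥0) : Prop where
  isCompact : IsCompact P.X
  nonempty : P.X.Nonempty
  g_convex : ∀ j, ConvexOn ℝ Set.univ (P.g j)
  g_diff : ∀ j, Differentiable ℝ (P.g j)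
  g_lip : ∀ j, LipschitzWith (Lg j) (gradient (P.g j))
  f_diff : ∀ x ∈ P.X, DifferentiableAt ℝ P.f x
  f_lip : LipschitzOnWith Lf (gradient P.f) P.X
  h_convex : ∀ i, ConvexOn ℝ Set.univ (P.h i)
  h_diff : ∀ i, ∀ x ∈ P.X, DifferentiableAt ℝ (P.h i) x
  h_lip : ∀ i, LipschitzOnWith (Lh i) (gradient (P.h i)) P.X

/-- The total violation of the constraints `h ≤ r`. -/
def violation (r : Euc m) (x : Euc n) : ℝ := ∑ i, max (P.h i x - r i) 0

/-- The exact penalty function minimized by `x*(r, z)`. -/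
def penalized (p B : ℝ) (r : Euc m) (z x : Euc n) : ℝ :=
  P.f x + p / 2 * ‖x - z‖ ^ 2 + B * P.violation r x

theorem xPert_eq {p B : ℝ} (hB : 0 ≤ B) (r : Euc m) (z : Euc n) :
    P.xPert p B r z = argminOn (P.penalized p B r z) P.X := by
  unfold xPert
  congr 1
  funext x
  rw [(isGreatest_inner_dualBox hB _).csSup_eq]
  simp only [penalized, violation, hVec, PiLp.sub_apply]
  ring

/-- This makes the quantity `‖x(z) - z‖` defining `Ω` accessible to the continuity of `xPert`. -/
theorem xProx_eq {p B : ℝ} (hB : 0 ≤ B) (z : Euc n) : P.xProx p B z = P.xPert p B 0 z := by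
  rw [P.xPert_eq hB]
  unfold xProx
  congr 1
  funext x
  have h := isGreatest_inner_dualBox hB (P.hVec x)
  have h' : IsGreatest ((fun y => P.proxLag p x z y) '' dualBox m B) (P.penalized p B 0 z x) := by
    have e : P.penalized p B 0 z x
        = P.f x + B * ∑ i, max (P.hVec x i) 0 + p / 2 * ‖x - z‖ ^ 2 := by
      simp only [penalized, violation, hVec, PiLp.zero_apply, sub_zero]; ring
    rw [e]
    constructor
    · obtain ⟨y, hy, hy'⟩ := h.1
      exact ⟨y, hy, by simp only [proxLag]; rw [← hy']⟩
    · rintro _ ⟨y, hy, rfl⟩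
      have := h.2 ⟨y, hy, rfl⟩
      simp only [proxLag]
      linarith
  exact h'.csSup_eq

variable {P}

theorem convexOn_violation (hh : ∀ i, ConvexOn ℝ Set.univ (P.h i)) (r : Euc m) :
    ConvexOn ℝ Set.univ (P.violation r) := by
  have : P.violation r = ∑ i, fun x => max (P.h i x - r i) 0 := by
    ext x; simp [violation]
  rw [this]
  refine Finset.sum_induction _ (fun V => ConvexOn ℝ Set.univ V) (fun _ _ => ConvexOn.add)
    (convexOn_const 0 convex_univ) fun i _ => ?_
  have h1 : ConvexOn ℝ Set.univ fun x => P.h i x - r i :=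
    (hh i).sub (concaveOn_const _ convex_univ)
  exact h1.sup (convexOn_const 0 convex_univ)

namespace IsSmoothConvex

variable {Lf : ℝ≥0} {Lh : Fin m → ℝ≥0} {Lg : Fin l → ℝ≥0}

theorem convex_X (H : P.IsSmoothConvex Lf Lh Lg) : Convex ℝ P.X := by
  have : P.X = ⋂ j, {x | x ∈ Set.univ ∧ P.g j x ≤ 0} := by ext x; simp [X]
  rw [this]
  exact convex_iInter fun j => (H.g_convex j).convex_le 0

theorem continuousOn_f (H : P.IsSmoothConvex Lf Lh Lg) : ContinuousOn P.f P.X := fun x hx =>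
  (H.f_diff x hx).continuousAt.continuousWithinAt

theorem continuousOn_h (H : P.IsSmoothConvex Lf Lh Lg) (i : Fin m) :
    ContinuousOn (P.h i) P.X := fun x hx =>
  (H.h_diff i x hx).continuousAt.continuousWithinAt

end IsSmoothConvex
end NLP

namespace NLP

variable {n m l : ℕ} {P : NLP n m l}

namespace IsSmoothConvex

variable {Lf : ℝ≥0} {Lh : Fin m → ℝ≥0} {Lg : Fin l → ℝ≥0}

theorem continuousOn_penalized (H : P.IsSmoothConvex Lf Lh Lg) (p B : ℝ) :
    ContinuousOn (fun q : (Euc m × Euc n) × Euc n => P.penalized p B q.1.1 q.1.2 q.2)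
      (Set.univ ×ˢ P.X) := by
  have hmap : Set.MapsTo (Prod.snd : (Euc m × Euc n) × Euc n → Euc n) (Set.univ ×ˢ P.X) P.X :=
    fun q hq => hq.2
  have hf := H.continuousOn_f.comp continuousOn_snd hmap
  have hh := fun i => (H.continuousOn_h i).comp continuousOn_snd hmap
  refine (hf.add (by fun_prop)).add (continuousOn_const.mul ?_)
  refine continuousOn_finsetSum _ fun i _ => ContinuousOn.sup ?_ continuousOn_const
  exact (hh i).sub (by fun_prop)

theorem continuousOn_penalized_right (H : P.IsSmoothConvex Lf Lh Lg) (p B : ℝ) (r : Euc m)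
    (z : Euc n) : ContinuousOn (P.penalized p B r z) P.X :=
  (H.continuousOn_penalized p B).comp
    (continuousOn_const.prodMk continuousOn_id : ContinuousOn (fun x => ((r, z), x)) P.X)
    fun _ hx => ⟨trivial, hx⟩

theorem hasGradientAt_prox (H : P.IsSmoothConvex Lf Lh Lg) (p : ℝ) (z : Euc n) {x : Euc n}
    (hx : x ∈ P.X) : HasGradientAt (fun x => P.f x + p / 2 * ‖x - z‖ ^ 2)
      (gradient P.f x + p • (x - z)) x := by
  have h1 := (H.f_diff x hx).hasGradientAt.hasFDerivAt
  have h2 := (((hasStrictFDerivAt_id x).hasFDerivAt.sub_const z).norm_sq).const_mul (p / 2)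
  rw [hasGradientAt_iff_hasFDerivAt]
  refine (h1.add h2).congr_fderiv ?_
  ext d
  simp
  ring

/-- By Cauchy–Schwarz, the nonconvex `f` costs at most `Lf ‖x - x'‖²`, while the proximal term
contributes `p ‖x - x'‖²`. -/
theorem prox_strongly_monotone (H : P.IsSmoothConvex Lf Lh Lg) (p : ℝ) (z : Euc n)
    {x x' : Euc n} (hx : x ∈ P.X) (hx' : x' ∈ P.X) :
    (p - Lf) * ‖x - x'‖ ^ 2 ≤
      inner ℝ ((gradient P.f x + p • (x - z)) - (gradient P.f x' + p • (x' - z))) (x - x') := by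
  have e : (gradient P.f x + p • (x - z)) - (gradient P.f x' + p • (x' - z))
      = (gradient P.f x - gradient P.f x') + p • (x - x') := by module
  rw [e, inner_add_left, inner_smul_left, real_inner_self_eq_norm_sq]
  have h1 := H.f_lip.dist_le_mul x hx x' hx'
  rw [dist_eq_norm, dist_eq_norm] at h1
  have h2 := abs_real_inner_le_norm (gradient P.f x - gradient P.f x') (x - x')
  have h3 := (abs_le.1 h2).1
  have h4 := mul_le_mul_of_nonneg_right h1 (norm_nonneg (x - x'))
  simp only [conj_trivial]
  nlinarith

theorem penalized_variational_inequality (H : P.IsSmoothConvex Lf Lh Lg) {p B : ℝ} (hB : 0 ≤ B)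
    {r : Euc m} {z x u : Euc n} (hx : x ∈ P.X) (hu : u ∈ P.X)
    (hmin : IsMinOn (P.penalized p B r z) P.X x) :
    0 ≤ inner ℝ (gradient P.f x + p • (x - z)) (u - x)
      + B * (P.violation r u - P.violation r x) := by
  have hV : ConvexOn ℝ P.X fun w => B • P.violation r w :=
    ((convexOn_violation H.h_convex r).subset (Set.subset_univ _) H.convex_X).smul hB
  have := IsMinOn.variational_inequality hV (H.hasGradientAt_prox p z hx) hx hu hmin
  simpa [mul_sub] using this

/-- Testing each minimizer against the other and adding cancels the penalty terms; strong
monotonicity leaves only `x = x'`. -/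
theorem eq_of_isMinOn_penalized (H : P.IsSmoothConvex Lf Lh Lg) {p B : ℝ} (hp : Lf < p)
    (hB : 0 ≤ B) {r : Euc m} {z x x' : Euc n} (hx : x ∈ P.X) (hx' : x' ∈ P.X)
    (hmin : IsMinOn (P.penalized p B r z) P.X x)
    (hmin' : IsMinOn (P.penalized p B r z) P.X x') : x = x' := by
  have h1 := H.penalized_variational_inequality hB hx hx' hmin
  have h2 := H.penalized_variational_inequality hB hx' hx hmin'
  have h3 := H.prox_strongly_monotone p z hx hx'
  rw [inner_sub_left] at h3
  rw [← neg_sub x x', inner_neg_right] at h1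
  have h4 : (p - Lf) * ‖x - x'‖ ^ 2 ≤ 0 := by linarith
  have h5 : 0 < p - Lf := by linarith
  have h6 : ‖x - x'‖ ^ 2 ≤ 0 := by
    by_contra! h
    nlinarith [mul_pos h5 h]
  have h7 : ‖x - x'‖ = 0 := pow_eq_zero_iff two_ne_zero |>.1 (le_antisymm h6 (sq_nonneg _))
  exact sub_eq_zero.1 (norm_eq_zero.1 h7)

theorem xPert_spec (H : P.IsSmoothConvex Lf Lh Lg) {p B : ℝ} (hB : 0 ≤ B) (r : Euc m)
    (z : Euc n) : P.xPert p B r z ∈ P.X ∧ IsMinOn (P.penalized p B r z) P.X (P.xPert p B r z) := by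
  rw [P.xPert_eq hB]
  exact argminOn_spec H.isCompact H.nonempty (H.continuousOn_penalized_right p B r z)

theorem xPert_mem (H : P.IsSmoothConvex Lf Lh Lg) {p B : ℝ} (hB : 0 ≤ B) (r : Euc m)
    (z : Euc n) : P.xPert p B r z ∈ P.X := (H.xPert_spec hB r z).1

theorem eq_xPert (H : P.IsSmoothConvex Lf Lh Lg) {p B : ℝ} (hp : Lf < p)
    (hB : 0 ≤ B) {r : Euc m} {z x : Euc n} (hx : x ∈ P.X)
    (hmin : IsMinOn (P.penalized p B r z) P.X x) : x = P.xPert p B r z :=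
  H.eq_of_isMinOn_penalized hp hB hx (H.xPert_spec hB r z).1 hmin (H.xPert_spec hB r z).2

theorem continuous_xPert (H : P.IsSmoothConvex Lf Lh Lg) {p B : ℝ} (hp : Lf < p) (hB : 0 ≤ B) :
    Continuous fun q : Euc m × Euc n => P.xPert p B q.1 q.2 :=
  continuous_of_unique_isMinOn H.isCompact (H.continuousOn_penalized p B)
    (fun q => H.xPert_mem hB q.1 q.2) (fun q => (H.xPert_spec hB q.1 q.2).2)
    fun _ _ hx hmin => H.eq_xPert hp hB hx hmin

theorem xDual_spec (H : P.IsSmoothConvex Lf Lh Lg) (p : ℝ) (y : Euc m) (z : Euc n) :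
    P.xDual p y z ∈ P.X ∧ IsMinOn (fun x => P.proxLag p x z y) P.X (P.xDual p y z) := by
  refine argminOn_spec H.isCompact H.nonempty ?_
  unfold proxLag
  have h1 : ContinuousOn P.hVec P.X :=
    (PiLp.continuous_toLp 2 _).comp_continuousOn (continuousOn_pi.2 H.continuousOn_h)
  exact (H.continuousOn_f.add (continuousOn_const.inner h1)).add (by fun_prop)

/-- Together with `proxLag_sub_le_penalized`, this is the saddle-point comparison: the shifted
Lagrangian lies below the penalty function and touches it where `y` is a best response. -/
theorem penalized_eq_of_forall_le {p B : ℝ} (hB : 0 ≤ B) {r y : Euc m} {z x : Euc n}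
    (hy : y ∈ dualBox m B)
    (hmax : ∀ u ∈ dualBox m B, inner ℝ u (P.hVec x - r) ≤ inner ℝ y (P.hVec x - r)) :
    P.penalized p B r z x = P.proxLag p x z y - inner ℝ y r := by
  have h : IsGreatest ((fun y => inner ℝ y (P.hVec x - r)) '' dualBox m B)
      (inner ℝ y (P.hVec x - r)) :=
    ⟨⟨y, hy, rfl⟩, by rintro _ ⟨u, hu, rfl⟩; exact hmax u hu⟩
  have e := (isGreatest_inner_dualBox hB (P.hVec x - r)).unique h
  have e' : B * P.violation r x = inner ℝ y (P.hVec x) - inner ℝ y r := by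
    rw [← inner_sub_right, ← e]
    simp [violation, hVec]
  rw [penalized, e', proxLag]
  ring

theorem proxLag_sub_le_penalized {p B : ℝ} (hB : 0 ≤ B) {r y : Euc m} {z x : Euc n}
    (hy : y ∈ dualBox m B) : P.proxLag p x z y - inner ℝ y r ≤ P.penalized p B r z x := by
  have h := (isGreatest_inner_dualBox hB (P.hVec x - r)).2 ⟨y, hy, rfl⟩
  have e' : B * P.violation r x = B * ∑ i, max ((P.hVec x - r) i) 0 := by
    simp [violation, hVec]
  simp only [inner_sub_right] at h
  rw [penalized, e', proxLag]
  linarith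

/-- After a projected dual step, the dual minimizer solves the perturbed problem. -/
theorem xPert_rTilde (H : P.IsSmoothConvex Lf Lh Lg) {p B α : ℝ} (hp : Lf < p) (hB : 0 ≤ B)
    (hα : 0 < α) (y : Euc m) (z : Euc n) :
    P.xPert p B (P.rTilde p B α y z) z = P.xDual p (P.yPlus p B α y z) z := by
  have hy : P.yPlus p B α y z ∈ dualBox m B := projOn_dualBox_mem hB _
  obtain ⟨hx, hmin⟩ := H.xDual_spec p (P.yPlus p B α y z) z
  refine (H.eq_xPert hp hB hx (isMinOn_iff.2 fun u hu => ?_)).symm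
  rw [penalized_eq_of_forall_le hB hy fun u hu => ?_]
  · exact (sub_le_sub_right (isMinOn_iff.1 hmin u hu) _).trans (proxLag_sub_le_penalized hB hy)
  · have hproj := inner_sub_projOn_dualBox_le hB (y + α • P.hVec (P.xDual p y z)) hu
    change inner ℝ (_ - P.yPlus p B α y z) (u - P.yPlus p B α y z) ≤ 0 at hproj
    -- The vector `r̃` is designed so that this residual is `1/α` times the projection residual; the
    -- projection inequality thus says that `y_+(z)` maximizes `⟨·, h - r̃⟩` over the box.
    have e : P.hVec (P.xDual p (P.yPlus p B α y z) z) - P.rTilde p B α y z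
        = α⁻¹ • (y + α • P.hVec (P.xDual p y z) - P.yPlus p B α y z) := by
      rw [rTilde, smul_sub, smul_add, inv_smul_smul₀ hα.ne']
      abel
    rw [← sub_nonpos, ← inner_sub_left, e, inner_smul_right, real_inner_comm]
    exact mul_nonpos_of_nonneg_of_nonpos (inv_pos.2 hα).le hproj

end IsSmoothConvex
end NLP

/-! ### Convex separation and Slater multipliers. -/

/-- Lagrange multipliers for a convex program satisfying Slater's condition. -/
theorem exists_lagrange_multiplier_of_slater {E ι : Type*} [AddCommGroup E] [Module ℝ E]
    [Fintype ι] {S : Set E} {ψ : E → ℝ} {c : ι → E → ℝ} (hψ : ConvexOn ℝ S ψ)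
    (hc : ∀ i, ConvexOn ℝ S (c i)) {x : E} (hx : x ∈ S) (hslater : ∀ i, c i x < 0)
    (hopt : ∀ u ∈ S, (∀ i, c i u < 0) → 0 ≤ ψ u) :
    ∃ y : ι → ℝ, (∀ i, 0 ≤ y i) ∧ ∀ u ∈ S, 0 ≤ ψ u + ∑ i, y i * c i u := by
  classical
  -- The strict upper image of `(ψ, c)` is open and convex, and optimality keeps `0` out of it, so a
  -- hyperplane separates the two.
  let A : Set (ℝ × (ι → ℝ)) := ⋃ u ∈ S, {q | ψ u < q.1 ∧ ∀ i, c i u < q.2 i}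
  have hmem : ∀ q : ℝ × (ι → ℝ), q ∈ A ↔ ∃ u ∈ S, ψ u < q.1 ∧ ∀ i, c i u < q.2 i := by
    intro q; simp [A, and_left_comm]
  have hAo : IsOpen A := by
    refine isOpen_biUnion fun u _ => ?_
    have h : {q : ℝ × (ι → ℝ) | ψ u < q.1 ∧ ∀ i, c i u < q.2 i}
        = {q | ψ u < q.1} ∩ ⋂ i, {q | c i u < q.2 i} := by
      ext q; simp
    rw [h]
    exact (isOpen_lt continuous_const continuous_fst).inter
      (isOpen_iInter_of_finite fun i => isOpen_lt continuous_const (by fun_prop))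
  have hAc : Convex ℝ A := by
    intro q hq q' hq' a b ha hb hab
    obtain ⟨u, hu, h1, h2⟩ := (hmem q).1 hq
    obtain ⟨u', hu', h1', h2'⟩ := (hmem q').1 hq'
    have key : ∀ {s s' t t' : ℝ}, s < t → s' < t' → a * s + b * s' < a * t + b * t' := by
      intro s s' t t' h h'
      rcases ha.eq_or_lt with rfl | ha
      · obtain rfl : b = 1 := by linarith
        linarith
      · linarith [mul_lt_mul_of_pos_left h ha, mul_le_mul_of_nonneg_left h'.le hb]
    exact (hmem _).2 ⟨a • u + b • u', hψ.1 hu hu' ha hb hab,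
      (hψ.2 hu hu' ha hb hab).trans_lt (key h1 h1'),
      fun i => ((hc i).2 hu hu' ha hb hab).trans_lt (key (h2 i) (h2' i))⟩
  have h0 : (0 : ℝ × (ι → ℝ)) ∉ A := fun h => by
    obtain ⟨u, hu, h1, h2⟩ := (hmem 0).1 h
    exact absurd (hopt u hu h2) (not_le.2 h1)
  obtain ⟨F, hF⟩ := geometric_hahn_banach_open_point hAc hAo h0
  rw [map_zero] at hF
  let c₀ : ℝ := -F (1, 0)
  let w : ι → ℝ := fun i => -F (0, Pi.single i 1)
  have hFe : ∀ q : ℝ × (ι → ℝ), -F q = c₀ * q.1 + ∑ i, w i * q.2 i := by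
    intro q
    have e : q = q.1 • ((1 : ℝ), (0 : ι → ℝ)) + ∑ i, q.2 i • ((0 : ℝ), (Pi.single i 1 : ι → ℝ)) := by
      ext j
      · simp [Prod.fst_sum]
      · simp [Prod.snd_sum, Finset.sum_apply, Pi.single_apply]
    conv_lhs => rw [e]
    rw [map_add, map_smul, map_sum, neg_add, ← Finset.sum_neg_distrib]
    congr 1
    · simp [c₀, mul_comm]
    · exact Finset.sum_congr rfl fun i _ => by rw [map_smul]; simp [w, mul_comm]
  have hpos : ∀ u ∈ S, ∀ ε : ℝ, ∀ δ : ι → ℝ, 0 < ε → (∀ i, 0 < δ i) →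
      0 < c₀ * (ψ u + ε) + ∑ i, w i * (c i u + δ i) := by
    intro u hu ε δ hε hδ
    have := hF (ψ u + ε, fun i => c i u + δ i)
      ((hmem _).2 ⟨u, hu, by simpa using hε, fun i => by simpa using hδ i⟩)
    have e := hFe (ψ u + ε, fun i => c i u + δ i)
    simp only at e
    linarith
  have hshift : ∀ u ∈ S, 0 ≤ c₀ * ψ u + ∑ i, w i * c i u := fun u hu =>
    nonneg_of_forall_pos_add_mul (T := c₀ + ∑ i, w i) fun ε hε => by
      have := hpos u hu ε (fun _ => ε) hε fun _ => hε
      simp only [mul_add, Finset.sum_add_distrib, ← Finset.sum_mul] at this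
      linarith
  -- The objective coordinate may be raised by `ε⁻¹`; multiplying by `ε` and letting `ε → 0`
  -- isolates `c₀`. The same device gives the signs of the `w j`.
  have hc₀ : 0 ≤ c₀ :=
    nonneg_of_forall_pos_add_mul (T := c₀ * ψ x + ∑ i, w i * (c i x + 1)) fun ε hε => by
      have := mul_pos hε (hpos x hx ε⁻¹ (fun _ => 1) (inv_pos.2 hε) fun _ => one_pos)
      rw [mul_add, mul_add c₀, mul_add, mul_left_comm ε c₀ ε⁻¹, mul_inv_cancel₀ hε.ne'] at this
      linarith
  have hw : ∀ j, 0 ≤ w j := fun j =>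
    nonneg_of_forall_pos_add_mul (T := c₀ * (ψ x + 1) + ∑ i, w i * (c i x + 1)) fun ε hε => by
      have := mul_pos hε (hpos x hx 1 (fun i => 1 + Pi.single (M := fun _ => ℝ) j ε⁻¹ i) one_pos
        fun i => by
          have : 0 ≤ Pi.single (M := fun _ => ℝ) j ε⁻¹ i := by
            rw [Pi.single_apply]; split_ifs
            · exact (inv_pos.2 hε).le
            · exact le_rfl
          linarith)
      have e : ∑ i, w i * (c i x + (1 + Pi.single (M := fun _ => ℝ) j ε⁻¹ i))
          = ∑ i, w i * (c i x + 1) + w j * ε⁻¹ := by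
        simp [mul_add, Finset.sum_add_distrib, Pi.single_apply]
        ring
      rw [e, ← add_assoc, mul_add, mul_left_comm ε (w j) ε⁻¹, mul_inv_cancel₀ hε.ne'] at this
      linarith
  -- If `c₀ = 0`, the Slater point forces every `w i` to vanish, contradicting strict separation.
  have hc₀' : 0 < c₀ := by
    refine hc₀.lt_of_ne fun h => ?_
    have h1 := hshift x hx
    rw [← h, zero_mul, zero_add] at h1
    have h2 : ∀ i ∈ Finset.univ, w i * c i x ≤ 0 := fun i _ =>
      mul_nonpos_of_nonneg_of_nonpos (hw i) (hslater i).le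
    have h3 := (Finset.sum_eq_zero_iff_of_nonpos h2).1 (le_antisymm (Finset.sum_nonpos h2) h1)
    have h4 : ∀ i, w i = 0 := fun i =>
      (mul_eq_zero.1 (h3 i (Finset.mem_univ i))).resolve_right (hslater i).ne
    have h5 := hpos x hx 1 (fun _ => 1) one_pos fun _ => one_pos
    simp [h4, ← h] at h5
  refine ⟨fun i => w i / c₀, fun i => div_nonneg (hw i) hc₀, fun u hu => ?_⟩
  have h := div_nonneg (hshift u hu) hc₀
  rw [add_div, mul_div_cancel_left₀ _ hc₀'.ne', Finset.sum_div] at h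
  simpa only [div_mul_eq_mul_div] using h

/-! ### Exactness of the penalty and optimality conditions. -/

namespace NLP

variable {n m l : ℕ} (P : NLP n m l)

/-- The constraint functions, indexed by `[m + l]`. -/
def con : Fin m ⊕ Fin l → Euc n → ℝ := Sum.elim P.h P.g

/-- The right-hand sides of the constraints `h ≤ r`, `g ≤ 0`. -/
def rhs (l : ℕ) (r : Euc m) : Fin m ⊕ Fin l → ℝ := Sum.elim r 0

variable {P}

theorem mem_activeSet {r : Euc m} {x : Euc n} {k : Fin m ⊕ Fin l} :
    k ∈ P.activeSet r x ↔ P.con k x = rhs l r k := by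
  cases k <;> rfl

theorem gradBound_nonneg : 0 ≤ P.gradBound :=
  Real.sSup_nonneg (by rintro _ ⟨x, _, rfl⟩; exact norm_nonneg _)

theorem diamX_nonneg : 0 ≤ P.diamX := Metric.diam_nonneg

namespace IsSmoothConvex

variable {Lf : ℝ≥0} {Lh : Fin m → ℝ≥0} {Lg : Fin l → ℝ≥0}

theorem norm_gradient_le (H : P.IsSmoothConvex Lf Lh Lg) {x : Euc n} (hx : x ∈ P.X) :
    ‖gradient P.f x‖ ≤ P.gradBound :=
  le_csSup (H.isCompact.image_of_continuousOn H.f_lip.continuousOn.norm).bddAbove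
    ⟨x, hx, rfl⟩

theorem norm_sub_le_diamX (H : P.IsSmoothConvex Lf Lh Lg) {x u : Euc n} (hx : x ∈ P.X)
    (hu : u ∈ P.X) : ‖x - u‖ ≤ P.diamX := by
  rw [← dist_eq_norm]
  exact Metric.dist_le_diam_of_mem H.isCompact.isBounded hx hu

theorem norm_prox_gradient_le (H : P.IsSmoothConvex Lf Lh Lg) {p : ℝ} (hp : 0 ≤ p)
    {x z : Euc n} (hx : x ∈ P.X) (hz : z ∈ P.X) :
    ‖gradient P.f x + p • (x - z)‖ ≤ P.gradBound + p * P.diamX := by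
  refine (norm_add_le _ _).trans (add_le_add (H.norm_gradient_le hx) ?_)
  rw [norm_smul, Real.norm_of_nonneg hp]
  exact mul_le_mul_of_nonneg_left (H.norm_sub_le_diamX hx hz) hp

theorem hasGradientAt_con (H : P.IsSmoothConvex Lf Lh Lg) {x : Euc n} (hx : x ∈ P.X)
    (k : Fin m ⊕ Fin l) : HasGradientAt (P.con k) (P.jacRow x k) x := by
  cases k with
  | inl i => exact (H.h_diff i x hx).hasGradientAt
  | inr j => exact (H.g_diff j x).hasGradientAt

theorem inner_jacRow_le (H : P.IsSmoothConvex Lf Lh Lg) {x : Euc n} (hx : x ∈ P.X)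
    (k : Fin m ⊕ Fin l) (u : Euc n) :
    inner ℝ (P.jacRow x k) (u - x) ≤ P.con k u - P.con k x := by
  cases k with
  | inl i => exact (H.h_convex i).inner_gradient_le (H.h_diff i x hx) u
  | inr j => exact (H.g_convex j).inner_gradient_le (H.g_diff j x) u

/-- The penalty is exact: `x*(r, z)` satisfies the perturbed constraints. -/
theorem h_xPert_le (H : P.IsSmoothConvex Lf Lh Lg) {p B Δ₀ : ℝ} (hp : 0 ≤ p)
    (hΔ₀ : 0 < Δ₀) (hslater : ∃ x ∈ P.X, ∀ i, P.h i x ≤ -Δ₀)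
    (hB : (4 * P.gradBound * P.diamX + 2 * p * P.diamX ^ 2) / Δ₀ < B) (hB0 : 0 ≤ B)
    {r : Euc m} (hr : ‖r‖ ≤ Δ₀ / 4) {z : Euc n} (hz : z ∈ P.X) (i : Fin m) :
    P.h i (P.xPert p B r z) ≤ r i := by
  classical
  obtain ⟨x₀, hx₀, hs⟩ := hslater
  obtain ⟨hx, hmin⟩ := H.xPert_spec (p := p) hB0 r z
  set x := P.xPert p B r z
  by_contra! hi
  set w := P.h i x - r i with hw
  have hw0 : 0 < w := sub_pos.2 hi
  -- As `r k ≥ -Δ₀ / 4`, the Slater point satisfies the perturbed constraints with margin `Δ₀ - Δ₀ /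
  -- 4`.
  set c := 3 * Δ₀ / 4 with hc
  have hc0 : 0 < c := by positivity
  -- The bound `s * c ≤ w` keeps `w - s * c` nonnegative, so a step of length `s` towards `x₀`
  -- lowers the positive part of constraint `i` by at least `s * c`.
  obtain ⟨s, hs0, hs1, hsw⟩ : ∃ s : ℝ, 0 < s ∧ s ≤ 1 ∧ s * c ≤ w := by
    refine ⟨min 1 (w / c), lt_min one_pos (div_pos hw0 hc0), min_le_left _ _, ?_⟩
    calc min 1 (w / c) * c ≤ w / c * c := mul_le_mul_of_nonneg_right (min_le_right _ _) hc0.le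
      _ = w := div_mul_cancel₀ _ hc0.ne'
  have hu := H.convex_X hx hx₀ (sub_nonneg.2 hs1) hs0.le (sub_add_cancel 1 s)
  set u := (1 - s) • x + s • x₀ with hu'
  have hk : ∀ k, P.h k u - r k ≤ (1 - s) * (P.h k x - r k) - s * c := by
    intro k
    have h1 := (H.h_convex k).2 (Set.mem_univ x) (Set.mem_univ x₀) (sub_nonneg.2 hs1) hs0.le
      (sub_add_cancel 1 s)
    simp only [smul_eq_mul] at h1
    have h2 : -(Δ₀ / 4) ≤ r k := by
      have := (PiLp.norm_apply_le r k).trans hr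
      rw [Real.norm_eq_abs] at this
      exact (abs_le.1 this).1
    have h3 : s * (P.h k x₀ - r k) ≤ s * -c :=
      mul_le_mul_of_nonneg_left (by rw [hc]; linarith [hs k]) hs0.le
    linarith
  have hV : P.violation r u ≤ P.violation r x - s * c := by
    have e : P.violation r x - s * c
        = ∑ k, (max (P.h k x - r k) 0 - if k = i then s * c else 0) := by
      simp [violation, Finset.sum_sub_distrib]
    rw [e]
    refine Finset.sum_le_sum fun k _ => ?_
    have h1 := hk k
    have h2 : (1 - s) * (P.h k x - r k) ≤ (1 - s) * max (P.h k x - r k) 0 :=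
      mul_le_mul_of_nonneg_left (le_max_left _ _) (sub_nonneg.2 hs1)
    have h3 : 0 ≤ s * max (P.h k x - r k) 0 := mul_nonneg hs0.le (le_max_right _ _)
    have h4 : 0 < s * c := mul_pos hs0 hc0
    split_ifs with hki
    · subst hki
      rw [max_eq_left hw0.le] at *
      exact max_le (by linarith) (by linarith)
    · exact max_le (by linarith) (by linarith [le_max_right (P.h k x - r k) 0])
  have hVI := H.penalized_variational_inequality hB0 hx hu hmin
  have e : u - x = s • (x₀ - x) := by rw [hu']; module
  rw [e, inner_smul_right] at hVI
  have h1 : inner ℝ (gradient P.f x + p • (x - z)) (x₀ - x)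
      ≤ (P.gradBound + p * P.diamX) * P.diamX :=
    (real_inner_le_norm _ _).trans (mul_le_mul (H.norm_prox_gradient_le hp hx hz)
      (H.norm_sub_le_diamX hx₀ hx) (norm_nonneg _)
      (add_nonneg gradBound_nonneg (mul_nonneg hp diamX_nonneg)))
  have h2 := mul_le_mul_of_nonneg_left h1 hs0.le
  have h3 := mul_le_mul_of_nonneg_left hV hB0
  have h4 : B * c ≤ (P.gradBound + p * P.diamX) * P.diamX := by
    refine le_of_mul_le_mul_left ?_ hs0
    linarith
  -- Three quarters of `4 ∇_f D_X + 2 p D_X²` is already at least `∇_f D_X + p D_X²`, so `h4`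
  -- contradicts the choice of `B`.
  rw [div_lt_iff₀ hΔ₀] at hB
  have h5 : 0 ≤ P.gradBound * P.diamX := mul_nonneg gradBound_nonneg diamX_nonneg
  have h6 : 0 ≤ p * P.diamX ^ 2 := mul_nonneg hp (sq_nonneg _)
  rw [hc] at h4
  nlinarith

theorem violation_eq_zero {r : Euc m} {x : Euc n} (h : ∀ i, P.h i x ≤ r i) :
    P.violation r x = 0 :=
  Finset.sum_eq_zero fun i _ => max_eq_right (by linarith [h i])

/-- The variational inequality for `x*(r, z)` over the points satisfying the perturbed
constraints. -/
theorem inner_sub_xPert_nonneg (H : P.IsSmoothConvex Lf Lh Lg) {p B : ℝ} (hB : 0 ≤ B)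
    {r : Euc m} {z : Euc n} (hfeas : ∀ i, P.h i (P.xPert p B r z) ≤ r i) {u : Euc n}
    (hu : u ∈ P.X) (hu' : ∀ i, P.h i u ≤ r i) :
    0 ≤ inner ℝ (gradient P.f (P.xPert p B r z) + p • (P.xPert p B r z - z))
      (u - P.xPert p B r z) := by
  obtain ⟨hx, hmin⟩ := H.xPert_spec (p := p) hB r z
  have := H.penalized_variational_inequality hB hx hu hmin
  rwa [violation_eq_zero hfeas, violation_eq_zero hu', sub_zero, mul_zero, add_zero] at this

/-- The Karush-Kuhn-Tucker conditions under linear independence of the active gradients. -/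
theorem exists_kkt (H : P.IsSmoothConvex Lf Lh Lg) {r : Euc m} {x v : Euc n} (hx : x ∈ P.X)
    (hfeas : ∀ i, P.h i x ≤ r i)
    (hopt : ∀ u ∈ P.X, (∀ i, P.h i u ≤ r i) → 0 ≤ inner ℝ v (u - x))
    {S : Finset (Fin m ⊕ Fin l)} (hS : (S : Set (Fin m ⊕ Fin l)) = P.activeSet r x)
    (hli : LinearIndependent ℝ fun k : S => P.jacRow x k) :
    ∃ c : Fin m ⊕ Fin l → ℝ, (∀ k, 0 ≤ c k) ∧ (∀ k ∉ S, c k = 0) ∧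
      v + ∑ k, c k • P.jacRow x k = 0 := by
  classical
  have hcon : ∀ k, P.con k x ≤ rhs l r k := by
    rintro (i | j)
    exacts [hfeas i, hx j]
  -- A direction strictly decreasing all active constraints is feasible for short steps, inactive
  -- ones being preserved by continuity; optimality then gives the hypothesis of Farkas' lemma.
  obtain ⟨c, hc, he⟩ := hli.exists_nonneg_combination (v := v) fun d hd => by
    have hev : ∀ᶠ t : ℝ in 𝓝[>] 0, ∀ k, P.con k (x + t • d) ≤ rhs l r k := by
      refine eventually_all.2 fun k => ?_
      by_cases hk : k ∈ S
      · have hk' : P.con k x = rhs l r k := mem_activeSet.1 (hS ▸ hk)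
        rw [← hk']
        exact ((H.hasGradientAt_con hx k).eventually_lt_of_inner_neg (hd ⟨k, hk⟩)).mono
          fun _ => le_of_lt
      · have hk' : P.con k x < rhs l r k := (hcon k).lt_of_ne fun h => hk <| by
          rw [← Finset.mem_coe, hS]; exact mem_activeSet.2 h
        have hct : Tendsto (fun t : ℝ => P.con k (x + t • d)) (𝓝[>] 0) (𝓝 (P.con k x)) := by
          have h0 : Tendsto (fun t : ℝ => x + t • d) (𝓝 0) (𝓝 x) := by
            have : Continuous fun t : ℝ => x + t • d := by fun_prop
            simpa using this.tendsto 0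
          exact (H.hasGradientAt_con hx k).continuousAt.tendsto.comp
            (h0.mono_left nhdsWithin_le_nhds)
        exact (hct.eventually_lt_const hk').mono fun _ => le_of_lt
    obtain ⟨t, ht, ht0⟩ := (hev.and self_mem_nhdsWithin).exists
    have ht0 : 0 < t := ht0
    have := hopt (x + t • d) (fun j => ht (Sum.inr j)) fun i => ht (Sum.inl i)
    rw [add_sub_cancel_left, inner_smul_right] at this
    exact nonneg_of_mul_nonneg_right this ht0
  refine ⟨fun k => if h : k ∈ S then c ⟨k, h⟩ else 0, fun k => ?_, fun k hk => dif_neg hk, ?_⟩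
  · dsimp only
    split_ifs
    exacts [hc _, le_rfl]
  · rw [← he]
    congr 1
    rw [← Finset.sum_subset (Finset.subset_univ S) fun k _ hk => by
        dsimp only; rw [dif_neg hk, zero_smul],
      ← Finset.sum_coe_sort S]
    exact Finset.sum_congr rfl fun k _ => by dsimp only; rw [dif_pos k.2]

/-- A fixed point of the proximal map is a stationary point. -/
theorem mem_stationarySet (H : P.IsSmoothConvex Lf Lh Lg) {p B Δ₀ : ℝ} (hp : 0 ≤ p)
    (hΔ₀ : 0 < Δ₀) (hslater : ∃ x ∈ P.X, ∀ i, P.h i x ≤ -Δ₀)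
    (hB : (4 * P.gradBound * P.diamX + 2 * p * P.diamX ^ 2) / Δ₀ < B) (hB0 : 0 ≤ B)
    {z : Euc n} (hz : z ∈ P.X) (hfix : P.xPert p B 0 z = z) : z ∈ P.stationarySet := by
  have hfeas : ∀ i, P.h i z ≤ 0 := fun i => by
    have := H.h_xPert_le hp hΔ₀ hslater hB hB0 (r := 0) (by rw [norm_zero]; positivity) hz i
    rwa [hfix] at this
  obtain ⟨x₀, hx₀, hs⟩ := hslater
  have hopt : ∀ u ∈ P.X, (∀ i, P.h i u < 0) → 0 ≤ inner ℝ (gradient P.f z) (u - z) := by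
    intro u hu hu'
    have := H.inner_sub_xPert_nonneg (p := p) hB0 (r := 0) (z := z)
      (by rw [hfix]; exact hfeas) hu fun i => (hu' i).le
    rwa [hfix, sub_self, smul_zero, add_zero] at this
  have hlin : ConvexOn ℝ P.X fun u => inner ℝ (gradient P.f z) (u - z) := by
    refine ⟨H.convex_X, fun u _ u' _ a b _ _ hab => le_of_eq ?_⟩
    have e : a • u + b • u' - z = a • (u - z) + b • (u' - z) := by
      rw [smul_sub, smul_sub, sub_add_sub_comm, ← add_smul, hab, one_smul]
    dsimp only
    rw [e, inner_add_right, inner_smul_right, inner_smul_right, smul_eq_mul, smul_eq_mul]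
  -- Only `h` is dualized: `X` stays an abstract convex set, matching the normal cone in the
  -- definition of stationarity. No constraint qualification on `g` is needed.
  obtain ⟨y, hy, hL⟩ := exists_lagrange_multiplier_of_slater hlin
    (fun i => (H.h_convex i).subset (Set.subset_univ _) H.convex_X) hx₀
    (fun i => (hs i).trans_lt (neg_lt_zero.2 hΔ₀)) hopt
  have hsum : ∑ i, y i * P.h i z = 0 := by
    refine le_antisymm (Finset.sum_nonpos fun i _ =>
      mul_nonpos_of_nonneg_of_nonpos (hy i) (hfeas i)) ?_
    simpa using hL z hz
  refine ⟨hz, WithLp.toLp 2 y, hy, fun u hu => ?_, hfeas, ?_⟩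
  · have hG : HasGradientAt (fun w => inner ℝ (gradient P.f z) (w - z) + ∑ i, y i * P.h i w)
        (gradient P.f z + ∑ i, y i • gradient (P.h i) z) z := by
      rw [hasGradientAt_iff_hasFDerivAt, map_add, map_sum]
      refine HasFDerivAt.add ?_ (HasFDerivAt.fun_sum fun i _ => ?_)
      · exact ((InnerProductSpace.toDual ℝ (Euc n)
          (gradient P.f z)).hasFDerivAt).comp z ((hasFDerivAt_id z).sub_const z)
      · rw [map_smulₛₗ]
        exact (H.h_diff i z hz).hasGradientAt.hasFDerivAt.const_mul (y i)
    have := IsMinOn.variational_inequality (convexOn_const (0 : ℝ) H.convex_X) hG hz hu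
      (isMinOn_iff.2 fun w hw => by simpa [hsum] using hL w hw)
    rw [sub_self, add_zero] at this
    rw [inner_neg_left]
    exact neg_nonpos.2 this
  · simpa [hVec, PiLp.inner_apply, mul_comm] using hsum

end IsSmoothConvex
end NLP

/-! ### Regularity, bounded multipliers and closedness. -/

namespace NLP

variable {n m l : ℕ} {P : NLP n m l}

theorem mul_norm_le_of_le_sigmaMin {S : Finset (Fin m ⊕ Fin l)} {x : Euc n} {s : ℝ}
    (h : ENNReal.ofReal s ≤ P.sigmaMin S x) (v : EuclideanSpace ℝ S) :
    s * ‖v‖ ≤ ‖∑ k : S, v k • P.jacRow x k‖ := by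
  rcases eq_or_ne v 0 with rfl | hv
  · simp
  have hv0 : 0 < ‖v‖ := norm_pos_iff.2 hv
  have h1 := (le_iInf₂_iff.1 h) (‖v‖⁻¹ • v) (norm_smul_inv_norm hv)
  rw [ENNReal.ofReal_le_ofReal_iff (norm_nonneg _)] at h1
  have e : ∑ k : S, (‖v‖⁻¹ • v) k • P.jacRow x k = ‖v‖⁻¹ • ∑ k : S, v k • P.jacRow x k := by
    simp only [Finset.smul_sum, PiLp.smul_apply, smul_assoc]
  rw [e, norm_smul, norm_inv, norm_norm, inv_mul_eq_div, le_div_iff₀ hv0] at h1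
  exact h1

theorem linearIndependent_of_le_sigmaMin {S : Finset (Fin m ⊕ Fin l)} {x : Euc n} {s : ℝ}
    (hs : 0 < s) (h : ENNReal.ofReal s ≤ P.sigmaMin S x) :
    LinearIndependent ℝ fun k : S => P.jacRow x k := by
  refine Fintype.linearIndependent_iff.2 fun c hc k => ?_
  have h1 := mul_norm_le_of_le_sigmaMin h (WithLp.toLp 2 c)
  simp only [hc, norm_zero] at h1
  have h2 : ‖(WithLp.toLp 2 c : EuclideanSpace ℝ S)‖ = 0 :=
    le_antisymm (nonpos_of_mul_nonpos_right h1 hs) (norm_nonneg _)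
  have h3 := norm_le_zero_iff.1 ((PiLp.norm_apply_le _ k).trans h2.le)
  exact h3

/-- Extending by zero outside `S` puts all multipliers in one space, where those of different points
can be subtracted. -/
theorem mul_norm_le_of_support_subset {S : Finset (Fin m ⊕ Fin l)} {x : Euc n} {s : ℝ}
    (h : ENNReal.ofReal s ≤ P.sigmaMin S x) {c : EuclideanSpace ℝ (Fin m ⊕ Fin l)}
    (hc : ∀ k ∉ S, c k = 0) : s * ‖c‖ ≤ ‖∑ k, c k • P.jacRow x k‖ := by
  have h1 := mul_norm_le_of_le_sigmaMin h (WithLp.toLp 2 fun k : S => c k)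
  have e1 : ‖(WithLp.toLp 2 fun k : S => c k : EuclideanSpace ℝ S)‖ = ‖c‖ := by
    rw [EuclideanSpace.norm_eq, EuclideanSpace.norm_eq]
    congr 1
    rw [← Finset.sum_subset (Finset.subset_univ S) fun k _ hk => by rw [hc k hk]; simp]
    exact Finset.sum_coe_sort S fun k => ‖c k‖ ^ 2
  have e2 : ∑ k : S, (WithLp.toLp 2 fun k : S => c k : EuclideanSpace ℝ S) k • P.jacRow x k
      = ∑ k, c k • P.jacRow x k := by
    rw [← Finset.sum_subset (Finset.subset_univ S) fun k _ hk => by rw [hc k hk, zero_smul]]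
    exact Finset.sum_coe_sort S fun k => c k • P.jacRow x k
  rwa [e1, e2] at h1

theorem norm_sq_sumElim (y : Euc m) (μ : Euc l) :
    ‖(WithLp.toLp 2 (Sum.elim y μ) : EuclideanSpace ℝ (Fin m ⊕ Fin l))‖ ^ 2
      = ‖y‖ ^ 2 + ‖μ‖ ^ 2 := by
  simp [EuclideanSpace.norm_sq_eq, Fintype.sum_sum_type]

theorem mem_Omega_smul {p B δ : ℝ} {r : Euc m} {z : Euc n} (h : (r, z) ∈ P.Omega p B δ)
    {t : ℝ} (ht : t ∈ Set.Icc (0 : ℝ) 1) : (t • r, z) ∈ P.Omega p B δ := by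
  have h' : max ‖P.xProx p B z - z‖ ‖r‖ ≤ δ := h
  refine max_le ((le_max_left _ _).trans h') (le_trans ?_ ((le_max_right _ _).trans h'))
  rw [norm_smul, Real.norm_of_nonneg ht.1]
  exact mul_le_of_le_one_left (norm_nonneg r) ht.2

variable (P)

/-- Multipliers of all constraints at `x*(r, z)`, supported on the set `S` of active constraints. -/
def IsMultiplier (p B : ℝ) (S : Finset (Fin m ⊕ Fin l)) (r : Euc m) (z : Euc n)
    (c : EuclideanSpace ℝ (Fin m ⊕ Fin l)) : Prop :=
  (∀ k, 0 ≤ c k) ∧ (∀ k ∉ S, c k = 0) ∧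
    (∀ k ∈ S, P.con k (P.xPert p B r z) = rhs l r k) ∧
    gradient P.f (P.xPert p B r z) + p • (P.xPert p B r z - z)
      + ∑ k, c k • P.jacRow (P.xPert p B r z) k = 0

variable {P}

theorem IsRegularityRadius.le_sigmaMin {p B Δ₀ σ δ : ℝ} (hδ : P.IsRegularityRadius p B Δ₀ σ δ)
    {r : Euc m} {z : Euc n} (hz : z ∈ P.X) (hr : (r, z) ∈ P.Omega p B δ)
    {S : Finset (Fin m ⊕ Fin l)} (hS : ∀ k ∈ S, P.con k (P.xPert p B r z) = rhs l r k) :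
    ENNReal.ofReal (σ / 2) ≤ P.sigmaMin S (P.xPert p B r z) :=
  hδ.2.2 r z hz hr S fun k hk => mem_activeSet.2 (hS k hk)

namespace IsSmoothConvex

variable {Lf : ℝ≥0} {Lh : Fin m → ℝ≥0} {Lg : Fin l → ℝ≥0}

theorem continuousOn_con (H : P.IsSmoothConvex Lf Lh Lg) (k : Fin m ⊕ Fin l) :
    ContinuousOn (P.con k) P.X := fun _ hx =>
  (H.hasGradientAt_con hx k).continuousAt.continuousWithinAt

theorem lipschitzOnWith_jacRow (H : P.IsSmoothConvex Lf Lh Lg) (k : Fin m ⊕ Fin l) :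
    LipschitzOnWith (Sum.elim Lh Lg k) (fun x => P.jacRow x k) P.X := by
  cases k with
  | inl i => exact H.h_lip i
  | inr j => exact (H.g_lip j).lipschitzOnWith

theorem continuous_con_xPert (H : P.IsSmoothConvex Lf Lh Lg) {p B : ℝ} (hp : Lf < p)
    (hB : 0 ≤ B) (k : Fin m ⊕ Fin l) :
    Continuous fun q : Euc m × Euc n => P.con k (P.xPert p B q.1 q.2) :=
  (H.continuousOn_con k).comp_continuous (H.continuous_xPert hp hB)
    fun q => H.xPert_mem hB q.1 q.2

theorem continuous_jacRow_xPert (H : P.IsSmoothConvex Lf Lh Lg) {p B : ℝ} (hp : Lf < p)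
    (hB : 0 ≤ B) (k : Fin m ⊕ Fin l) :
    Continuous fun q : Euc m × Euc n => P.jacRow (P.xPert p B q.1 q.2) k :=
  (H.lipschitzOnWith_jacRow k).continuousOn.comp_continuous (H.continuous_xPert hp hB)
    fun q => H.xPert_mem hB q.1 q.2

theorem continuous_gradient_xPert (H : P.IsSmoothConvex Lf Lh Lg) {p B : ℝ} (hp : Lf < p)
    (hB : 0 ≤ B) : Continuous fun q : Euc m × Euc n => gradient P.f (P.xPert p B q.1 q.2) :=
  H.f_lip.continuousOn.comp_continuous (H.continuous_xPert hp hB)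
    fun q => H.xPert_mem hB q.1 q.2

theorem continuous_rhs (l : ℕ) (k : Fin m ⊕ Fin l) : Continuous fun r : Euc m => rhs l r k := by
  cases k with
  | inl i => exact PiLp.continuous_apply 2 _ i
  | inr j => exact continuous_const

theorem exists_isRegularityRadius (H : P.IsSmoothConvex Lf Lh Lg) {p B Δ₀ σ : ℝ} (hp : Lf < p)
    (hΔ₀ : 0 < Δ₀) (hslater : ∃ x ∈ P.X, ∀ i, P.h i x ≤ -Δ₀)
    (hB : (4 * P.gradBound * P.diamX + 2 * p * P.diamX ^ 2) / Δ₀ < B) (hB0 : 0 ≤ B)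
    (hσ : 0 < σ) (hσ_le : ENNReal.ofReal σ ≤ P.sigmaStar) :
    ∃ δ, P.IsRegularityRadius p B Δ₀ σ δ := by
  have hp0 : 0 ≤ p := Lf.2.trans hp.le
  have key : ∀ S : Finset (Fin m ⊕ Fin l), ∃ δ > 0, ∀ (r : Euc m) (z : Euc n)
      (v : EuclideanSpace ℝ S), ‖r‖ ≤ Δ₀ / 4 → z ∈ P.X → ‖v‖ = 1 →
      (∀ k ∈ S, P.con k (P.xPert p B r z) = rhs l r k) →
      ‖∑ k : S, v k • P.jacRow (P.xPert p B r z) k‖ ≤ σ / 2 →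
      δ ≤ max ‖P.xPert p B 0 z - z‖ ‖r‖ := by
    intro S
    -- The set of failures of regularity for this `S`; continuity of `xPert` makes it compact.
    let T : Set ((Euc m × Euc n) × EuclideanSpace ℝ S) :=
      ((Metric.closedBall 0 (Δ₀ / 4) ×ˢ P.X) ×ˢ Metric.sphere 0 1) ∩
        {q | (∀ k ∈ S, P.con k (P.xPert p B q.1.1 q.1.2) = rhs l q.1.1 k) ∧
          ‖∑ k : S, q.2 k • P.jacRow (P.xPert p B q.1.1 q.1.2) k‖ ≤ σ / 2}
    have hT : IsCompact T := by
      refine IsCompact.inter_right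
        (((isCompact_closedBall _ _).prod H.isCompact).prod (isCompact_sphere _ _)) ?_
      have e : {q : (Euc m × Euc n) × EuclideanSpace ℝ S |
          (∀ k ∈ S, P.con k (P.xPert p B q.1.1 q.1.2) = rhs l q.1.1 k) ∧
          ‖∑ k : S, q.2 k • P.jacRow (P.xPert p B q.1.1 q.1.2) k‖ ≤ σ / 2}
          = (⋂ k ∈ S, {q | P.con k (P.xPert p B q.1.1 q.1.2) = rhs l q.1.1 k}) ∩
            {q | ‖∑ k : S, q.2 k • P.jacRow (P.xPert p B q.1.1 q.1.2) k‖ ≤ σ / 2} := by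
        ext q; simp
      rw [e]
      refine (isClosed_biInter fun k _ => isClosed_eq
        ((H.continuous_con_xPert hp hB0 k).comp continuous_fst)
        ((continuous_rhs l k).comp (continuous_fst.comp continuous_fst))).inter
        (isClosed_le (Continuous.norm (continuous_finsetSum _ fun k _ => ?_)) continuous_const)
      exact ((PiLp.continuous_apply 2 _ k).comp continuous_snd).smul
        ((H.continuous_jacRow_xPert hp hB0 k).comp continuous_fst)
    have hρ : Continuous fun q : (Euc m × Euc n) × EuclideanSpace ℝ S =>
        max ‖P.xPert p B 0 q.1.2 - q.1.2‖ ‖q.1.1‖ := by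
      have h1 : Continuous fun q : (Euc m × Euc n) × EuclideanSpace ℝ S =>
          P.xPert p B 0 q.1.2 := (H.continuous_xPert hp hB0).comp
            (f := fun q : (Euc m × Euc n) × EuclideanSpace ℝ S => ((0 : Euc m), q.1.2))
            (by fun_prop)
      exact (h1.sub (by fun_prop)).norm.max (by fun_prop)
    -- On `T` the distance function is positive: at a zero, `z` is stationary and the norm is at
    -- least `σ`, not at most `σ / 2`. A positive lower bound also exists when `T` is empty.
    obtain ⟨δ, hδ0, hδ⟩ := hT.exists_forall_le' hρ.continuousOn (a := 0) (by
      rintro ⟨⟨r, z⟩, v⟩ ⟨⟨⟨-, hz⟩, hv⟩, hact, hle⟩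
      simp only at hz hact hle ⊢
      by_contra! hcon
      have hr0 : r = 0 := norm_le_zero_iff.1 ((le_max_right _ _).trans hcon)
      have hfix : P.xPert p B 0 z = z :=
        sub_eq_zero.1 (norm_le_zero_iff.1 ((le_max_left _ _).trans hcon))
      subst hr0
      rw [hfix] at hact hle
      have hst := H.mem_stationarySet hp0 hΔ₀ hslater hB hB0 hz hfix
      have h1 : ENNReal.ofReal σ ≤ P.sigmaMin S z :=
        hσ_le.trans (iInf₂_le_of_le z hst
          (iInf₂_le S fun k hk => mem_activeSet.2 (hact k hk)))
      have h2 := mul_norm_le_of_le_sigmaMin h1 v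
      rw [mem_sphere_zero_iff_norm.1 hv] at h2
      linarith)
    exact ⟨δ, hδ0, fun r z v hr hz hv hact hle =>
      hδ ((r, z), v) ⟨⟨⟨mem_closedBall_zero_iff.2 hr, hz⟩, mem_sphere_zero_iff_norm.2 hv⟩,
        hact, hle⟩⟩
  choose d hd0 hd using key
  have hev : ∀ᶠ δ : ℝ in 𝓝[>] 0, (∀ S, δ < d S) ∧ δ < Δ₀ / 4 :=
    (eventually_all.2 fun S => mem_nhdsWithin_of_mem_nhds (Iio_mem_nhds (hd0 S))).and
      (mem_nhdsWithin_of_mem_nhds (Iio_mem_nhds (by positivity)))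
  obtain ⟨δ, ⟨hδd, hδΔ⟩, hδ0⟩ := (hev.and self_mem_nhdsWithin).exists
  refine ⟨δ, hδ0, hδΔ.le, fun r z hz hr S hS => ?_⟩
  by_contra! hlt
  obtain ⟨v, hv⟩ := iInf_lt_iff.1 hlt
  obtain ⟨hv1, hv⟩ := iInf_lt_iff.1 hv
  have hle := (ENNReal.ofReal_lt_ofReal_iff (half_pos hσ)).1 hv
  have hr' : max ‖P.xProx p B z - z‖ ‖r‖ ≤ δ := hr
  rw [P.xProx_eq hB0] at hr'
  have := hd S r z v (((le_max_right _ _).trans hr').trans hδΔ.le) hz hv1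
    (fun k hk => mem_activeSet.1 (hS hk)) hle.le
  linarith [hδd S]

/-- The KKT equation equates `J_Sᵀ c` with minus the proximal gradient, of norm at most `∇_f + p
D_X`; dividing by `σ / 2` produces the factor 2 in `Λ`. -/
theorem norm_le_multBound (H : P.IsSmoothConvex Lf Lh Lg) {p B Δ₀ σ δ : ℝ} (hp : 0 ≤ p)
    (hB : 0 ≤ B) (hσ : 0 < σ) (hδ : P.IsRegularityRadius p B Δ₀ σ δ) {r : Euc m} {z : Euc n}
    (hz : z ∈ P.X) (hr : (r, z) ∈ P.Omega p B δ) {S : Finset (Fin m ⊕ Fin l)}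
    {c : EuclideanSpace ℝ (Fin m ⊕ Fin l)} (hc : P.IsMultiplier p B S r z c) :
    ‖c‖ ≤ P.multBound p σ := by
  obtain ⟨-, hc0, hact, hkkt⟩ := hc
  have h1 := mul_norm_le_of_support_subset (hδ.le_sigmaMin hz hr hact) hc0
  rw [eq_neg_of_add_eq_zero_right hkkt, norm_neg] at h1
  have h2 := H.norm_prox_gradient_le hp (H.xPert_mem (p := p) hB r z) hz
  rw [multBound, le_div_iff₀ hσ]
  linarith

theorem isBasicSet_of_isMultiplier (H : P.IsSmoothConvex Lf Lh Lg) {p B Δ₀ σ δ : ℝ} (hp : 0 ≤ p)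
    (hB : 0 ≤ B) (hσ : 0 < σ) (hδ : P.IsRegularityRadius p B Δ₀ σ δ) {r : Euc m} {z : Euc n}
    (hz : z ∈ P.X) (hr : (r, z) ∈ P.Omega p B δ) {S : Finset (Fin m ⊕ Fin l)}
    {c : EuclideanSpace ℝ (Fin m ⊕ Fin l)} (hc : P.IsMultiplier p B S r z c) :
    P.IsBasicSet p B (P.multBound p σ) S r z := by
  have hΛ := H.norm_le_multBound hp hB hσ hδ hz hr hc
  obtain ⟨hpos, hc0, hact, hkkt⟩ := hc
  refine ⟨linearIndependent_of_le_sigmaMin (half_pos hσ) (hδ.le_sigmaMin hz hr hact),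
    WithLp.toLp 2 fun i => c (Sum.inl i), WithLp.toLp 2 fun j => c (Sum.inr j),
    fun i => hpos _, fun j => hpos _, ?_, fun i hi => hact _ hi, fun j hj => hact _ hj,
    fun i hi => hc0 _ hi, fun j hj => hc0 _ hj, ?_⟩
  · rw [Fintype.sum_sum_type] at hkkt
    rw [← hkkt]
    simp only [jacRow]
    abel
  · have h := norm_sq_sumElim (WithLp.toLp 2 fun i => c (Sum.inl i) : Euc m)
      (WithLp.toLp 2 fun j => c (Sum.inr j) : Euc l)
    have e : (WithLp.toLp 2 (Sum.elim (WithLp.toLp 2 fun i => c (Sum.inl i) : Euc m)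
        (WithLp.toLp 2 fun j => c (Sum.inr j) : Euc l)) :
          EuclideanSpace ℝ (Fin m ⊕ Fin l)) = c := by
      ext k; cases k <;> rfl
    rw [e] at h
    exact max_le ((sq_le_sq₀ (norm_nonneg _) (norm_nonneg c)).1
        (h ▸ le_add_of_nonneg_right (sq_nonneg _)) |>.trans hΛ)
      ((sq_le_sq₀ (norm_nonneg _) (norm_nonneg c)).1
        (h ▸ le_add_of_nonneg_left (sq_nonneg _)) |>.trans hΛ)

/-- The full active set serves as `S`: regularity makes its gradients independent, which is the
constraint qualification `exists_kkt` requires. -/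
theorem exists_isMultiplier (H : P.IsSmoothConvex Lf Lh Lg) {p B Δ₀ σ δ : ℝ} (hp : 0 ≤ p)
    (hΔ₀ : 0 < Δ₀) (hslater : ∃ x ∈ P.X, ∀ i, P.h i x ≤ -Δ₀)
    (hB : (4 * P.gradBound * P.diamX + 2 * p * P.diamX ^ 2) / Δ₀ < B) (hB0 : 0 ≤ B)
    (hσ : 0 < σ) (hδ : P.IsRegularityRadius p B Δ₀ σ δ) {r : Euc m} {z : Euc n}
    (hz : z ∈ P.X) (hr : (r, z) ∈ P.Omega p B δ) :
    ∃ S c, P.IsMultiplier p B S r z c := by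
  classical
  let S : Finset (Fin m ⊕ Fin l) :=
    Finset.univ.filter fun k => P.con k (P.xPert p B r z) = rhs l r k
  have hS : (S : Set (Fin m ⊕ Fin l)) = P.activeSet r (P.xPert p B r z) := by
    ext k; simp [S, mem_activeSet]
  have hact : ∀ k ∈ S, P.con k (P.xPert p B r z) = rhs l r k := fun k hk => by
    simpa [S] using hk
  have hr' : ‖r‖ ≤ Δ₀ / 4 := ((le_max_right _ _).trans hr).trans hδ.2.1
  have hfeas := H.h_xPert_le hp hΔ₀ hslater hB hB0 hr' hz
  obtain ⟨c, hc, hc0, hkkt⟩ := H.exists_kkt (H.xPert_mem hB0 r z) hfeas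
    (fun u hu hu' => H.inner_sub_xPert_nonneg hB0 hfeas hu hu') hS
    (linearIndependent_of_le_sigmaMin (half_pos hσ) (hδ.le_sigmaMin hz hr hact))
  exact ⟨S, WithLp.toLp 2 c, hc, hc0, hact, hkkt⟩

/-- Fixing `S` expresses complementarity through equalities, which pass to limits although the
active set itself can jump. -/
theorem isClosed_isMultiplier (H : P.IsSmoothConvex Lf Lh Lg) {p B : ℝ} (hp : Lf < p)
    (hB : 0 ≤ B) (S : Finset (Fin m ⊕ Fin l)) :
    IsClosed {q : (Euc m × Euc n) × EuclideanSpace ℝ (Fin m ⊕ Fin l) |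
      P.IsMultiplier p B S q.1.1 q.1.2 q.2} := by
  have hcoord : ∀ k, Continuous fun q : (Euc m × Euc n) × EuclideanSpace ℝ (Fin m ⊕ Fin l) =>
      q.2 k := fun k => (PiLp.continuous_apply 2 _ k).comp continuous_snd
  have h1 : IsClosed {q : (Euc m × Euc n) × EuclideanSpace ℝ (Fin m ⊕ Fin l) |
      ∀ k, 0 ≤ q.2 k} := by
    simp only [Set.ofPred_forall]
    exact isClosed_iInter fun k => isClosed_le continuous_const (hcoord k)
  have h2 : IsClosed {q : (Euc m × Euc n) × EuclideanSpace ℝ (Fin m ⊕ Fin l) |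
      ∀ k ∉ S, q.2 k = 0} := by
    simp only [Set.ofPred_forall]
    exact isClosed_biInter fun k _ => isClosed_eq (hcoord k) continuous_const
  have h3 : IsClosed {q : (Euc m × Euc n) × EuclideanSpace ℝ (Fin m ⊕ Fin l) |
      ∀ k ∈ S, P.con k (P.xPert p B q.1.1 q.1.2) = rhs l q.1.1 k} := by
    simp only [Set.ofPred_forall]
    exact isClosed_biInter fun k _ => isClosed_eq
      ((H.continuous_con_xPert hp hB k).comp continuous_fst)
      ((continuous_rhs l k).comp (continuous_fst.comp continuous_fst))
  have h4 : IsClosed {q : (Euc m × Euc n) × EuclideanSpace ℝ (Fin m ⊕ Fin l) |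
      gradient P.f (P.xPert p B q.1.1 q.1.2) + p • (P.xPert p B q.1.1 q.1.2 - q.1.2)
        + ∑ k, q.2 k • P.jacRow (P.xPert p B q.1.1 q.1.2) k = 0} := by
    refine isClosed_eq (Continuous.add ?_ (continuous_finsetSum _ fun k _ => ?_)) continuous_const
    · exact ((H.continuous_gradient_xPert hp hB).add
        (((H.continuous_xPert hp hB).sub continuous_snd).const_smul p)).comp continuous_fst
    · exact (hcoord k).smul ((H.continuous_jacRow_xPert hp hB k).comp continuous_fst)
  exact h1.inter (h2.inter (h3.inter h4))

/-- Along a segment, the parameters with multipliers supported on a given set are closed. -/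
theorem isClosed_setOf_exists_isMultiplier (H : P.IsSmoothConvex Lf Lh Lg) {p B : ℝ} (hp : Lf < p)
    (hB : 0 ≤ B) (S : Finset (Fin m ⊕ Fin l)) (r : Euc m) (z : Euc n) (Λ : ℝ) :
    IsClosed {t : ℝ | t ∈ Set.Icc (0 : ℝ) 1 ∧
      ∃ c, ‖c‖ ≤ Λ ∧ P.IsMultiplier p B S (t • r) z c} := by
  have hcl : IsClosed {q : ℝ × EuclideanSpace ℝ (Fin m ⊕ Fin l) |
      P.IsMultiplier p B S (q.1 • r) z q.2} :=
    (H.isClosed_isMultiplier hp hB S).preimage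
      (f := fun q : ℝ × EuclideanSpace ℝ (Fin m ⊕ Fin l) => ((q.1 • r, z), q.2)) (by fun_prop)
  -- The bound `Λ` makes the set of pairs `(t, c)` compact, so its projection to `t` is closed.
  have hW := ((isCompact_Icc (a := (0 : ℝ)) (b := 1)).prod
    (isCompact_closedBall (0 : EuclideanSpace ℝ (Fin m ⊕ Fin l)) Λ)).inter_right hcl
  convert (hW.image continuous_fst).isClosed using 1
  ext t
  constructor
  · rintro ⟨ht, c, hc, hm⟩
    exact ⟨(t, c), ⟨⟨ht, mem_closedBall_zero_iff.2 hc⟩, hm⟩, rfl⟩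
  · rintro ⟨⟨t', c⟩, ⟨⟨ht, hc⟩, hm⟩, rfl⟩
    exact ⟨ht, c, mem_closedBall_zero_iff.1 hc, hm⟩

/-! ### Lipschitz dependence on the perturbation. -/

/-- The Lipschitz estimate for two perturbations with multipliers supported on a common set. -/
theorem norm_xPert_sub_le (H : P.IsSmoothConvex Lf Lh Lg) {p B Δ₀ σ δ : ℝ} (hp : Lf < p)
    (hB : 0 ≤ B) (hσ : 0 < σ) (hδ : P.IsRegularityRadius p B Δ₀ σ δ) {r r' : Euc m} {z : Euc n}
    (hz : z ∈ P.X) (hr : (r, z) ∈ P.Omega p B δ) (hr' : (r', z) ∈ P.Omega p B δ)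
    {S : Finset (Fin m ⊕ Fin l)} {c c' : EuclideanSpace ℝ (Fin m ⊕ Fin l)}
    (hc : P.IsMultiplier p B S r z c) (hc' : P.IsMultiplier p B S r' z c') :
    ‖P.xPert p B r z - P.xPert p B r' z‖ ≤
      2 * (Lf + p + P.multBound p σ * Real.sqrt (rootSumSq Lh ^ 2 + rootSumSq Lg ^ 2))
        / ((p - Lf) * σ) * ‖r - r'‖ := by
  have hp0 : 0 ≤ p := Lf.2.trans hp.le
  have hΛ := H.norm_le_multBound hp0 hB hσ hδ hz hr' hc'
  obtain ⟨hpos, hc0, hact, hkkt⟩ := hc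
  obtain ⟨hpos', hc0', hact', hkkt'⟩ := hc'
  have hσmin := hδ.le_sigmaMin hz hr hact
  have hx := H.xPert_mem (p := p) hB r z
  have hx' := H.xPert_mem (p := p) hB r' z
  set x := P.xPert p B r z
  set x' := P.xPert p B r' z
  set v := gradient P.f x + p • (x - z)
  set v' := gradient P.f x' + p • (x' - z)
  set Lip := Real.sqrt (rootSumSq Lh ^ 2 + rootSumSq Lg ^ 2) with hLip
  have hv : v = -∑ k, c k • P.jacRow x k := eq_neg_of_add_eq_zero_left hkkt
  have hv' : v' = -∑ k, c' k • P.jacRow x' k := eq_neg_of_add_eq_zero_left hkkt'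
  have hmono : (p - Lf) * ‖x - x'‖ ^ 2 ≤ ‖c - c'‖ * ‖r - r'‖ := by
    have h1 := H.prox_strongly_monotone p z hx hx'
    change _ ≤ inner ℝ (v - v') (x - x') at h1
    have h2 : inner ℝ (v - v') (x - x')
        = ∑ k, (c' k * inner ℝ (P.jacRow x' k) (x - x')
          + c k * inner ℝ (P.jacRow x k) (x' - x)) := by
      rw [hv, hv', ← neg_sub x x', Finset.sum_add_distrib]
      simp only [inner_sub_left, inner_neg_left, inner_neg_right, sum_inner, inner_smul_left,
        conj_trivial, mul_neg, Finset.sum_neg_distrib]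
      ring
    -- Tangent-plane inequalities at both points, weighted by nonnegative multipliers. On `S` both
    -- constraints hold with equality, so only the right-hand sides remain.
    have h3 : ∀ k, c' k * inner ℝ (P.jacRow x' k) (x - x')
          + c k * inner ℝ (P.jacRow x k) (x' - x) ≤ (c' k - c k) * (rhs l r k - rhs l r' k) := by
      intro k
      by_cases hk : k ∈ S
      · have h4 := mul_le_mul_of_nonneg_left (H.inner_jacRow_le hx' k x) (hpos' k)
        have h5 := mul_le_mul_of_nonneg_left (H.inner_jacRow_le hx k x') (hpos k)
        rw [hact k hk, hact' k hk] at h4 h5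
        linarith
      · simp [hc0 k hk, hc0' k hk]
    have h4 : ∑ k, (c' k - c k) * (rhs l r k - rhs l r' k)
        = inner ℝ (c' - c) (WithLp.toLp 2 (Sum.elim (r - r') (0 : Euc l))) := by
      simp [PiLp.inner_apply, Fintype.sum_sum_type, rhs, mul_comm]
    have h5 : ‖(WithLp.toLp 2 (Sum.elim (r - r') (0 : Euc l)) :
        EuclideanSpace ℝ (Fin m ⊕ Fin l))‖ = ‖r - r'‖ := by
      have := norm_sq_sumElim (r - r') (0 : Euc l)
      rw [norm_zero, zero_pow two_ne_zero, add_zero] at this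
      exact (sq_eq_sq₀ (norm_nonneg _) (norm_nonneg _)).1 this
    have h6 := real_inner_le_norm (c' - c) (WithLp.toLp 2 (Sum.elim (r - r') (0 : Euc l)))
    rw [h5, ← h4, norm_sub_rev] at h6
    exact ((h1.trans h2.le).trans (Finset.sum_le_sum fun k _ => h3 k)).trans h6
  have hgrad : ‖v - v'‖ ≤ (Lf + p) * ‖x - x'‖ := by
    have e : v - v' = (gradient P.f x - gradient P.f x') + p • (x - x') := by
      simp only [v, v']; module
    have h1 := H.f_lip.dist_le_mul x hx x' hx'
    rw [dist_eq_norm, dist_eq_norm] at h1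
    rw [e, add_mul]
    refine (norm_add_le _ _).trans (add_le_add h1 ?_)
    rw [norm_smul, Real.norm_of_nonneg hp0]
  have hjac : ‖∑ k, c' k • (P.jacRow x k - P.jacRow x' k)‖
      ≤ P.multBound p σ * Lip * ‖x - x'‖ := by
    have h1 : ∀ k, ‖c' k • (P.jacRow x k - P.jacRow x' k)‖
        ≤ c' k * (Sum.elim Lh Lg k : ℝ≥0) * ‖x - x'‖ := by
      intro k
      have h2 := (H.lipschitzOnWith_jacRow k).dist_le_mul x hx x' hx'
      rw [dist_eq_norm, dist_eq_norm] at h2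
      rw [norm_smul, Real.norm_of_nonneg (hpos' k), mul_assoc]
      exact mul_le_mul_of_nonneg_left h2 (hpos' k)
    refine (norm_sum_le _ _).trans ((Finset.sum_le_sum fun k _ => h1 k).trans ?_)
    rw [← Finset.sum_mul]
    refine mul_le_mul_of_nonneg_right ?_ (norm_nonneg _)
    refine (Real.sum_mul_le_sqrt_mul_sqrt _ _ _).trans ?_
    have e1 : Real.sqrt (∑ k, c' k ^ 2) = ‖c'‖ := by
      rw [EuclideanSpace.norm_eq]; simp
    have e2 : Real.sqrt (∑ k, ((Sum.elim Lh Lg k : ℝ≥0) : ℝ) ^ 2) = Lip := by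
      rw [hLip, rootSumSq, rootSumSq, Real.sq_sqrt (Finset.sum_nonneg fun _ _ => sq_nonneg _),
        Real.sq_sqrt (Finset.sum_nonneg fun _ _ => sq_nonneg _), Fintype.sum_sum_type]
      rfl
    rw [e1, e2]
    exact mul_le_mul_of_nonneg_right hΛ (Real.sqrt_nonneg _)
  have hmult : σ / 2 * ‖c - c'‖ ≤ (Lf + p + P.multBound p σ * Lip) * ‖x - x'‖ := by
    refine (mul_norm_le_of_support_subset hσmin (c := c - c') fun k hk => by
      simp [hc0 k hk, hc0' k hk]).trans ?_
    -- Subtracting the KKT equations with the Jacobian difference charged to `c'` leaves `J(x)ᵀ (c -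
    -- c')`, to which regularity at `x` applies.
    have e : ∑ k, (c - c') k • P.jacRow x k
        = -(v - v') - ∑ k, c' k • (P.jacRow x k - P.jacRow x' k) := by
      rw [hv, hv']
      simp only [PiLp.sub_apply, sub_smul, smul_sub, Finset.sum_sub_distrib]
      abel
    rw [e]
    refine (norm_sub_le _ _).trans ?_
    rw [norm_neg]
    linarith
  have hμ : 0 < p - Lf := sub_pos.2 hp
  -- Combining `hmono` and `hmult` yields the estimate multiplied by `‖x - x'‖`, so the zero case is
  -- separated before cancelling.
  rcases (norm_nonneg (x - x')).eq_or_lt with h0 | h0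
  · rw [← h0] at hmult ⊢
    have : 0 ≤ P.multBound p σ := (norm_nonneg _).trans hΛ
    positivity
  · rw [div_mul_eq_mul_div, le_div_iff₀ (mul_pos hμ hσ)]
    refine le_of_mul_le_mul_right ?_ h0
    have h1 := mul_le_mul_of_nonneg_right hmono hσ.le
    have h2 := mul_le_mul_of_nonneg_right hmult (norm_nonneg (r - r'))
    nlinarith

end IsSmoothConvex
end NLP

end

/-! ### Assembly along the segment from `0` to `r̃`. -/

theorem mainTheorem3 {n m l : ℕ} (P : NLP n m l)
    (Lf : ℝ≥0) (Lh : Fin m → ℝ≥0) (Lg : Fin l → ℝ≥0)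
    -- basic assumptions
    (hX : IsCompact P.X)
    (hg_convex : ∀ j, ConvexOn ℝ Set.univ (P.g j))
    (hg_diff : ∀ j, Differentiable ℝ (P.g j))
    (hg_lip : ∀ j, LipschitzWith (Lg j) (gradient (P.g j)))
    (hf_diff : ∀ x ∈ P.X, DifferentiableAt ℝ P.f x)
    (hf_lip : LipschitzOnWith Lf (gradient P.f) P.X)
    (hh_convex : ∀ i, ConvexOn ℝ Set.univ (P.h i))
    (hh_diff : ∀ i, ∀ x ∈ P.X, DifferentiableAt ℝ (P.h i) x)
    (hh_lip : ∀ i, LipschitzOnWith (Lh i) (gradient (P.h i)) P.X)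
    -- regularity assumptions
    (Δ₀ : ℝ) (hΔ₀ : 0 < Δ₀) (h_slater : ∃ x ∈ P.X, ∀ i, P.h i x ≤ -Δ₀)
    (σ : ℝ) (hσ : 0 < σ) (hσ_le : ENNReal.ofReal σ ≤ P.sigmaStar)
    -- choice of the parameters
    (p : ℝ) (hp : (Lf : ℝ) < p)
    (B : ℝ) (hB : (4 * P.gradBound * P.diamX + 2 * p * P.diamX ^ 2) / Δ₀ < B) :
    (∃ δ : ℝ, P.IsRegularityRadius p B Δ₀ σ δ) ∧
    ∀ δ : ℝ, P.IsRegularityRadius p B Δ₀ σ δ →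
      ∀ α : ℝ, 0 < α → ∀ z ∈ P.X, ∀ y ∈ dualBox m B,
        (P.rTilde p B α y z, z) ∈ P.Omega p B δ →
        P.xPert p B (P.rTilde p B α y z) z = P.xDual p (P.yPlus p B α y z) z ∧
        (∃ (K : ℕ) (θ : Fin (K + 1) → ℝ), θ 0 = 0 ∧ θ (Fin.last K) = 1 ∧ StrictMono θ ∧
          ∀ k : Fin K, P.ShareBasicSet p B (P.multBound p σ) δ
            (θ k.castSucc • P.rTilde p B α y z) (θ k.succ • P.rTilde p B α y z) z) ∧
        ‖P.xPert p B (P.rTilde p B α y z) z - P.xPert p B 0 z‖ ≤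
          2 * (Lf + p + P.multBound p σ * Real.sqrt (rootSumSq Lh ^ 2 + rootSumSq Lg ^ 2))
            / ((p - Lf) * σ) * ‖P.rTilde p B α y z‖ := by
  obtain ⟨x₀, hx₀, -⟩ := id h_slater
  have H : P.IsSmoothConvex Lf Lh Lg := ⟨hX, ⟨x₀, hx₀⟩, hg_convex, hg_diff, hg_lip, hf_diff,
    hf_lip, hh_convex, hh_diff, hh_lip⟩
  have hp0 : 0 ≤ p := Lf.2.trans hp.le
  have hB0 : 0 ≤ B := by
    refine le_trans (div_nonneg (add_nonneg ?_ ?_) hΔ₀.le) hB.le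
    · exact mul_nonneg (mul_nonneg zero_le_four NLP.gradBound_nonneg) NLP.diamX_nonneg
    · exact mul_nonneg (mul_nonneg zero_le_two hp0) (sq_nonneg _)
  refine ⟨H.exists_isRegularityRadius hp hΔ₀ h_slater hB hB0 hσ hσ_le, ?_⟩
  intro δ hδ α hα z hz y _ hr
  refine ⟨H.xPert_rTilde hp hB0 hα y z, ?_⟩
  set r := P.rTilde p B α y z
  obtain ⟨K, θ, hθ0, hθ1, hθ, hshare⟩ := exists_partition_of_finite_closed_cover
    (fun S => H.isClosed_setOf_exists_isMultiplier hp hB0 S r z (P.multBound p σ)) zero_le_one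
    fun t ht => by
      obtain ⟨S, c, hc⟩ := H.exists_isMultiplier hp0 hΔ₀ h_slater hB hB0 hσ hδ hz
        (NLP.mem_Omega_smul hr ht)
      exact ⟨S, ht, c, H.norm_le_multBound hp0 hB0 hσ hδ hz (NLP.mem_Omega_smul hr ht) hc, hc⟩
  refine ⟨⟨K, θ, hθ0, hθ1, hθ, fun k => ?_⟩, ?_⟩
  · obtain ⟨S, ⟨ht, c, -, hc⟩, ⟨ht', c', -, hc'⟩⟩ := hshare k
    have hr₁ := NLP.mem_Omega_smul hr ht
    have hr₂ := NLP.mem_Omega_smul hr ht'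
    exact ⟨hr₁, hr₂, S, H.isBasicSet_of_isMultiplier hp0 hB0 hσ hδ hz hr₁ hc,
      H.isBasicSet_of_isMultiplier hp0 hB0 hσ hδ hz hr₂ hc'⟩
  -- Each increment is bounded proportionally to `θ k.succ - θ k.castSucc`, so the sum telescopes
  -- and the constant is independent of `K`.
  · have hstep : ∀ k : Fin K, dist (P.xPert p B (θ k.succ • r) z)
        (P.xPert p B (θ k.castSucc • r) z) ≤
        2 * (Lf + p + P.multBound p σ * Real.sqrt (rootSumSq Lh ^ 2 + rootSumSq Lg ^ 2))
          / ((p - Lf) * σ) * ‖r‖ * (θ k.succ - θ k.castSucc) := by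
      intro k
      obtain ⟨S, ⟨ht, c, -, hc⟩, ⟨ht', c', -, hc'⟩⟩ := hshare k
      have h := H.norm_xPert_sub_le hp hB0 hσ hδ hz (NLP.mem_Omega_smul hr ht')
        (NLP.mem_Omega_smul hr ht) hc' hc
      rw [← sub_smul, norm_smul, Real.norm_of_nonneg
        (sub_nonneg.2 (hθ.monotone (Fin.castSucc_le_succ k)))] at h
      rw [dist_eq_norm]
      linarith
    have h := dist_le_of_forall_dist_succ_le
      (x := fun k => P.xPert p B (θ k • r) z) hstep (Fin.last K)
    simpa only [hθ0, hθ1, one_smul, zero_smul, sub_zero, mul_one, dist_eq_norm] using h
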